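/- Every irrational $x\in[0,1)$ has a unique regular continued fraction expansion $x=[a_1(x),a_2(x),\ldots]=\cfrac{1}{a_1(x)+\cfrac{1}{a_2(x)+\cdots}}$ with integers $a_i(x)\geq 1$. Let $\varphi:\{1,2,3,\ldots\}\to[2,\infty)$ be non-decreasing, and let $\mathcal F_3(\varphi)$ be the set of all irrational $x\in[0,1)$ such that for infinitely many $n\geq 1$ there are integers $1\leq j<k\leq n$ with $$a_j(x)a_{j+1}(x)a_{j+2}(x)\geq\varphi(n)\quad\text{and}\quad a_k(x)a_{k+1}(x)a_{k+2}(x)\geq\varphi(n).$$ Then $\mathcal F_3(\varphi)$ is a Borel set, and its Lebesgue measure is $0$ if $$\sum_{n\geq 1}\left(\frac{n\log^4\varphi(n)}{\varphi(n)^2}+\frac{\log\varphi(n)}{\varphi(n)}\right)$$ converges, and is $1$ if this series diverges. -/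

import Mathlib

open MeasureTheory Filter

/-- The `n`-th partial quotient `a_n(x)` of the regular continued fraction
`x = [a_0(x); a_1(x), a_2(x), …]`. For irrational `x` the expansion is infinite and every `a_n(x)`
is defined; for rational `x`, the value `0` is assigned after the expansion has ended. -/
noncomputable def partialQuotient (x : ℝ) : ℕ → ℝ
  | 0 => (GenContFract.of x).h
  | n + 1 => ((GenContFract.of x).partDens.get? n).getD 0

/-- The product `a_j(x) a_{j+1}(x) ⋯ a_{j+ℓ-1}(x)` of `ℓ` consecutive partial quotients. -/
noncomputable def blockProduct (ℓ : ℕ) (x : ℝ) (j : ℕ) : ℝ :=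
  ∏ i ∈ Finset.range ℓ, partialQuotient x (j + i)

/-- The set `F_ℓ(φ)` of the irrational `x ∈ [0,1)` such that, for infinitely many `n`, there are
`1 ≤ j < k ≤ n` for which the products of the `ℓ` consecutive partial quotients that start at `j`
and at `k` are both at least `φ(n)`. -/
def largeProductSet (ℓ : ℕ) (φ : ℕ → ℝ) : Set ℝ :=
  {x | x ∈ Set.Ico (0 : ℝ) 1 ∧ Irrational x ∧
    ∃ᶠ n : ℕ in atTop, ∃ j k : ℕ, 1 ≤ j ∧ j < k ∧ k ≤ n ∧
      φ n ≤ blockProduct ℓ x j ∧ φ n ≤ blockProduct ℓ x k}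

namespace PartialQuotients

open Set
open scoped ENNReal

/-! Given a cylinder of order n with q_{n-1}/q_n = s, the remainder has density (1+s)/(1+sy)^2. The
digits therefore form a chain with state s: a digit is drawn with `digitWeight s`, and the state
moves to `nextState s` (`digitLaw_apply_eq_tsum`). Since a digit a has weight between 1/(3a^2) and
2/a^2 for every s, bounds uniform in s can be multiplied along the chain as if the digits were
independent, up to constants (`digitLaw_inter_shift_le`, `digitLaw_forall_notMem_le`).

Under such weights a product of k+1 digits exceeds t with probability of order log^k t / t. Two
disjoint triples are thus both large with probability at most of order log^4 t / t^2. Two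
overlapping triples cost only log t / t at most: their common digits can make both large at once.

Convergence: let k be the later of the two starting positions. By monotonicity the threshold may be
lowered to that of the least admissible n, and a union bound over the about n disjoint and two
overlapping positions of the earlier triple gives the terms of the series (`digitLaw_pairSet_le`).
The first Borel–Cantelli lemma finishes.

Divergence: one of the two series diverges. If it is the one of log φ/φ, infinitely many disjoint
pairs of neighbouring digits have a large product, and each pair lies in two consecutive triples.
Otherwise the digits are cut into blocks of doubling length, and large triples are sought in both
halves of a block; condensation turns the series over n into one over blocks. In both cases
`ae_frequently_shift_mem` replaces independence. -/

/-- Prepend a digit to a sequence of digits. -/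
def consDigit (b : ℕ) (σ : ℕ → ℕ) : ℕ → ℕ
  | 0 => b
  | n + 1 => σ n

/-- Drop the first `k` digits. -/
def shift (k : ℕ) (σ : ℕ → ℕ) : ℕ → ℕ := fun n => σ (n + k)

/-- The Gauss map. -/
noncomputable def gaussMap (x : ℝ) : ℝ := Int.fract x⁻¹

/-- The sequence of the partial quotients of `x`, each lowered by one. -/
noncomputable def digits (x : ℝ) : ℕ → ℕ := fun n => ⌊(gaussMap^[n] x)⁻¹⌋₊ - 1

/-- The density on `[0, 1)` of the law of the remainder `T^n x`, conditional on a cylinder of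
order `n` whose denominators satisfy `q_{n-1} / q_n = s`. -/
noncomputable def remainderDensity (s : unitInterval) (y : ℝ) : ℝ≥0∞ :=
  ENNReal.ofReal ((1 + (s : ℝ)) / (1 + s * y) ^ 2)

/-- The law of the digits under the density `remainderDensity s` on `[0, 1)`. -/
noncomputable def digitLaw (s : unitInterval) : Measure (ℕ → ℕ) :=
  ((volume.restrict (Ico (0 : ℝ) 1)).withDensity (remainderDensity s)).map digits

/-- The probability of the first digit `b` under `digitLaw s`. -/
noncomputable def digitWeight (s : unitInterval) (b : ℕ) : ℝ :=
  (1 + (s : ℝ)) / ((b + 1 + s) * (b + 1 + s + 1))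

/-- The quotient of consecutive denominators after the digit `b`. -/
noncomputable def nextState (s : unitInterval) (b : ℕ) : unitInterval :=
  ⟨1 / (b + 1 + (s : ℝ)), by
    have := s.2.1
    refine ⟨by positivity, ?_⟩
    rw [div_le_one (by positivity)]
    have : (0 : ℝ) ≤ b := by positivity
    linarith⟩

/-! ### Digits, the Gauss map and the chain of digit laws. -/

lemma measurable_gaussMap : Measurable gaussMap := measurable_fract.comp measurable_inv

lemma measurable_digits : Measurable digits := by
  refine measurable_pi_lambda _ fun n => ?_
  have h : Measurable fun x : ℝ => ⌊(gaussMap^[n] x)⁻¹⌋₊ :=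
    Nat.measurable_floor.comp (measurable_inv.comp (measurable_gaussMap.iterate n))
  exact (measurable_from_top (f := fun m : ℕ => m - 1)).comp h

lemma measurable_consDigit (b : ℕ) : Measurable (consDigit b) := by
  refine measurable_pi_lambda _ fun n => ?_
  cases n with
  | zero => exact measurable_const
  | succ n => exact measurable_pi_apply n

lemma measurable_shift (k : ℕ) : Measurable (shift k) :=
  measurable_pi_lambda _ fun n => measurable_pi_apply (n + k)

lemma digits_eq_consDigit (x : ℝ) : digits x = consDigit (digits x 0) (digits (gaussMap x)) := by
  funext n
  cases n with
  | zero => rfl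
  | succ n => simp [digits, consDigit]

lemma digits_one_div (b : ℕ) {y : ℝ} (hy : y ∈ Ico (0 : ℝ) 1) :
    digits (1 / (b + 1 + y)) = consDigit b (digits y) := by
  have h1 : (1 / ((b : ℝ) + 1 + y))⁻¹ = ((b + 1 : ℕ) : ℝ) + y := by push_cast; simp
  rw [digits_eq_consDigit]
  have hG : gaussMap (1 / (b + 1 + y)) = y := by
    rw [gaussMap, h1, Int.fract_natCast_add, Int.fract_eq_self]
    exact hy
  have h0 : digits (1 / (b + 1 + y)) 0 = b := by
    simp only [digits, Function.iterate_zero, id]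
    rw [h1, add_comm, Nat.floor_add_natCast hy.1, Nat.floor_eq_zero.2 hy.2]
    simp
  rw [hG, h0]

lemma Ioc_eq_iUnion_image :
    Ioc (0 : ℝ) 1 = ⋃ b : ℕ, (fun y : ℝ => 1 / (b + 1 + y)) '' Ico 0 1 := by
  ext x
  simp only [mem_iUnion, mem_image]
  constructor
  · rintro ⟨h0, h1⟩
    have hx : 1 ≤ x⁻¹ := (one_le_inv₀ h0).2 h1
    have hfl : 1 ≤ ⌊x⁻¹⌋₊ := Nat.le_floor (by simpa using hx)
    refine ⟨⌊x⁻¹⌋₊ - 1, x⁻¹ - ⌊x⁻¹⌋₊, ⟨?_, ?_⟩, ?_⟩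
    · linarith [Nat.floor_le (zero_le_one.trans hx)]
    · linarith [Nat.lt_floor_add_one x⁻¹]
    · rw [Nat.cast_sub hfl]; simp
  · rintro ⟨b, y, ⟨h0, h1⟩, rfl⟩
    have hb : (0 : ℝ) ≤ b := by positivity
    refine ⟨by positivity, ?_⟩
    rw [div_le_one (by positivity)]; linarith

lemma digitLaw_apply (s : unitInterval) {E : Set (ℕ → ℕ)} (hE : MeasurableSet E) :
    digitLaw s E = ∫⁻ y in Ico 0 1 ∩ digits ⁻¹' E, remainderDensity s y := by
  rw [digitLaw, Measure.map_apply measurable_digits hE,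
    withDensity_apply _ (measurable_digits hE), Measure.restrict_restrict (measurable_digits hE),
    inter_comm]

/-- Change of variables on each inverse branch y ↦ 1/(b+1+y) of the Gauss map: the density times the
Jacobian is a constant multiple of the density with parameter 1/(b+1+s), so the family of laws is
closed under conditioning on the first digit. -/
lemma digitLaw_apply_eq_tsum (s : unitInterval) {E : Set (ℕ → ℕ)} (hE : MeasurableSet E) :
    digitLaw s E = ∑' b : ℕ, ENNReal.ofReal (digitWeight s b) *
      digitLaw (nextState s b) (consDigit b ⁻¹' E) := by
  have hs := s.2.1
  -- The branches over [0,1) tile (0,1] rather than [0,1); the endpoints are null.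
  have hae : (Ico 0 1 ∩ digits ⁻¹' E : Set ℝ) =ᵐ[volume] (Ioc 0 1 ∩ digits ⁻¹' E : Set ℝ) :=
    (Ico_ae_eq_Ioc).inter (ae_eq_refl _)
  have hU : (Ioc 0 1 ∩ digits ⁻¹' E : Set ℝ) =
      ⋃ b : ℕ, (fun y : ℝ => 1 / (b + 1 + y)) '' (Ico 0 1 ∩ digits ⁻¹' (consDigit b ⁻¹' E)) := by
    rw [Ioc_eq_iUnion_image, iUnion_inter]
    refine iUnion_congr fun b => ?_
    ext x
    constructor
    · rintro ⟨⟨y, hy, rfl⟩, hx⟩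
      refine ⟨y, ⟨hy, ?_⟩, rfl⟩
      simpa only [mem_preimage, digits_one_div b hy] using hx
    · rintro ⟨y, ⟨hy, hx⟩, rfl⟩
      refine ⟨⟨y, hy, rfl⟩, ?_⟩
      simpa only [mem_preimage, digits_one_div b hy] using hx
  have hmeas (b : ℕ) : MeasurableSet (Ico 0 1 ∩ digits ⁻¹' (consDigit b ⁻¹' E) : Set ℝ) :=
    measurableSet_Ico.inter (measurable_digits (measurable_consDigit b hE))
  have hinj (b : ℕ) (A : Set ℝ) : InjOn (fun y : ℝ => 1 / ((b : ℝ) + 1 + y)) A := by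
    intro x _ y _ hxy
    simpa using hxy
  have himg (b : ℕ) : MeasurableSet ((fun y : ℝ => 1 / ((b : ℝ) + 1 + y)) ''
      (Ico 0 1 ∩ digits ⁻¹' (consDigit b ⁻¹' E))) := by
    have : (fun y : ℝ => 1 / ((b : ℝ) + 1 + y)) ''
        (Ico 0 1 ∩ digits ⁻¹' (consDigit b ⁻¹' E)) =
        (fun x : ℝ => x⁻¹ - (b + 1)) ⁻¹' (Ico 0 1 ∩ digits ⁻¹' (consDigit b ⁻¹' E)) := by
      ext x
      constructor
      · rintro ⟨y, hy, rfl⟩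
        simpa using hy
      · intro hx
        exact ⟨_, hx, by simp⟩
    rw [this]
    exact (measurable_inv.sub_const _) (hmeas b)
  have hdisj : Pairwise (Function.onFun Disjoint fun b : ℕ => (fun y : ℝ => 1 / ((b : ℝ) + 1 + y)) ''
      (Ico 0 1 ∩ digits ⁻¹' (consDigit b ⁻¹' E))) := by
    intro b c hbc
    refine Set.disjoint_left.2 ?_
    rintro _ ⟨y, ⟨hy, -⟩, rfl⟩ ⟨z, ⟨hz, -⟩, hyz⟩
    have := congrFun (digits_one_div b hy) 0
    beta_reduce at hyz
    rw [← hyz, digits_one_div c hz] at this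
    exact hbc this.symm
  rw [digitLaw_apply s hE, setLIntegral_congr hae, hU, lintegral_iUnion himg hdisj]
  refine tsum_congr fun b => ?_
  rw [digitLaw_apply _ (measurable_consDigit b hE),
    lintegral_image_eq_lintegral_abs_deriv_mul (f' := fun y => -1 / ((b : ℝ) + 1 + y) ^ 2)
      (hmeas b) ?_ (hinj b _), ← lintegral_const_mul']
  · refine setLIntegral_congr_fun (hmeas b) fun y hy => ?_
    have hy0 := hy.1.1
    have e1 : (0 : ℝ) < (b : ℝ) + 1 + y := by positivity
    have e2 : (0 : ℝ) < (b : ℝ) + 1 + s := by positivity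
    have e3 : (0 : ℝ) < (b : ℝ) + 1 + s + 1 := by positivity
    have e4 : (0 : ℝ) < (b : ℝ) + 1 + s + y := by positivity
    simp only [remainderDensity, digitWeight, nextState]
    rw [← ENNReal.ofReal_mul (abs_nonneg _), ← ENNReal.ofReal_mul (by positivity)]
    congr 1
    rw [abs_div, abs_neg, abs_one, abs_of_pos (by positivity)]
    have h1 : 1 + (s : ℝ) * (1 / (b + 1 + y)) = (b + 1 + s + y) / (b + 1 + y) := by
      field_simp; ring
    have h2 : 1 + 1 / ((b : ℝ) + 1 + s) * y = (b + 1 + s + y) / (b + 1 + s) := by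
      field_simp
    have h3 : 1 + 1 / ((b : ℝ) + 1 + s) = (b + 1 + s + 1) / (b + 1 + s) := by
      field_simp
    rw [h1, h2, h3]
    field_simp
  · exact ENNReal.ofReal_ne_top
  · intro y hy
    have e1 : (b : ℝ) + 1 + y ≠ 0 := by have := hy.1.1; positivity
    have := ((hasDerivAt_id y).const_add ((b : ℝ) + 1)).inv e1
    refine HasDerivAt.hasDerivWithinAt ?_
    simp only [one_div]
    exact this

instance isProbabilityMeasure_digitLaw (s : unitInterval) : IsProbabilityMeasure (digitLaw s) := by
  refine ⟨?_⟩
  have hs := s.2.1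
  rw [digitLaw_apply s MeasurableSet.univ, preimage_univ, inter_univ]
  have hpos {y : ℝ} (hy : 0 ≤ y) : (0 : ℝ) < 1 + s * y := by positivity
  have hcont : ContinuousOn (fun y : ℝ => (1 + (s : ℝ)) / (1 + s * y) ^ 2) (uIcc 0 1) := by
    refine continuousOn_const.div (by fun_prop) fun y hy => ?_
    rw [uIcc_of_le zero_le_one] at hy
    exact (pow_pos (hpos hy.1) 2).ne'
  have hint := hcont.intervalIntegrable (μ := volume)
  -- The antiderivative (1+s)y/(1+sy) vanishes at 0 and equals 1 at 1.
  have hFTC := intervalIntegral.integral_eq_sub_of_hasDerivAt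
    (f := fun y : ℝ => (1 + (s : ℝ)) * y / (1 + s * y)) (a := 0) (b := 1) (fun y hy => ?_) hint
  · rw [intervalIntegral.integral_of_le zero_le_one, mul_one, mul_one,
      div_self (by positivity)] at hFTC
    rw [intervalIntegrable_iff_integrableOn_Ioc_of_le zero_le_one] at hint
    rw [setLIntegral_congr Ico_ae_eq_Ioc]
    simp only [remainderDensity]
    rw [← ofReal_integral_eq_lintegral_ofReal hint, hFTC]
    · simp
    · exact ae_of_all _ fun y => by simp only [Pi.zero_apply]; positivity
  · rw [uIcc_of_le zero_le_one] at hy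
    have h := (((hasDerivAt_id y).const_mul (1 + (s : ℝ))).div
      (((hasDerivAt_id y).const_mul (s : ℝ)).const_add 1) (hpos hy.1).ne')
    refine h.congr_deriv ?_
    simp only [id]
    congr 1
    ring

lemma digitLaw_zero : digitLaw 0 = (volume.restrict (Ico (0 : ℝ) 1)).map digits := by
  have : remainderDensity 0 = 1 := by
    funext y
    simp [remainderDensity]
  rw [digitLaw, this, withDensity_one]

/-! ### Digit weights uniform in the state; digits as partial quotients. -/

lemma digitWeight_le (s : unitInterval) (b : ℕ) : digitWeight s b ≤ 2 / ((b : ℝ) + 1) ^ 2 := by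
  have h0 := s.2.1
  have h1 := s.2.2
  rw [digitWeight, div_le_div_iff₀ (by positivity) (by positivity)]
  have hb : (0 : ℝ) ≤ b := by positivity
  nlinarith [mul_nonneg hb h0]

lemma le_digitWeight (s : unitInterval) (b : ℕ) : 1 / (3 * ((b : ℝ) + 1) ^ 2) ≤ digitWeight s b := by
  have h0 := s.2.1
  have h1 := s.2.2
  have hb : (0 : ℝ) ≤ b := by positivity
  rw [digitWeight, div_le_div_iff₀ (by positivity) (by positivity), one_mul]
  have h2 : (b : ℝ) + 1 + s ≤ (1 + s) * (b + 1) := by nlinarith [mul_nonneg hb h0]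
  calc ((b : ℝ) + 1 + s) * (b + 1 + s + 1) ≤ ((1 + s) * (b + 1)) * (3 * (b + 1)) := by
        gcongr
        linarith
    _ = _ := by ring

lemma partDens_get?_of_irrational (n : ℕ) {x : ℝ} (hx : Irrational x) :
    (GenContFract.of x).partDens.get? n = some (digits (Int.fract x) n + 1 : ℝ) := by
  induction n generalizing x with
  | zero =>
    have hfr : Irrational (Int.fract x) := by
      rw [← Int.self_sub_floor]; exact hx.sub_intCast _
    have h1 : 1 ≤ (Int.fract x)⁻¹ :=
      (one_le_inv₀ ((Int.fract_nonneg x).lt_of_ne' hfr.ne_zero)).2 (Int.fract_lt_one x).le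
    have hfl : 1 ≤ ⌊(Int.fract x)⁻¹⌋₊ := Nat.le_floor (by simpa using h1)
    have h := GenContFract.of_s_head hfr.ne_zero
    rw [GenContFract.partDens, Stream'.Seq.map_get?]
    change Option.map _ (GenContFract.of x).s.head = _
    rw [h]
    simp only [Option.map_some, digits, Function.iterate_zero, id, Nat.cast_sub hfl]
    rw [natCast_floor_eq_intCast_floor (zero_le_one.trans h1)]
    simp
  | succ n ih =>
    have hfr : Irrational (Int.fract x)⁻¹ := by
      rw [irrational_inv_iff, ← Int.self_sub_floor]; exact hx.sub_intCast _
    rw [GenContFract.partDens, Stream'.Seq.map_get?, GenContFract.of_s_succ,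
      ← Stream'.Seq.map_get?]
    -- The fractional part of `(Int.fract x)⁻¹` is by definition the Gauss map at `Int.fract x`.
    exact (ih hfr).trans (by rw [digits_eq_consDigit (Int.fract x)]; rfl)

lemma partialQuotient_succ {x : ℝ} (hx : Irrational x) (h : x ∈ Ico (0 : ℝ) 1) (n : ℕ) :
    partialQuotient x (n + 1) = digits x n + 1 := by
  rw [partialQuotient, partDens_get?_of_irrational n hx, Int.fract_eq_self.2 h]
  rfl

/-! ### Conditioning on the past and Borel–Cantelli for blocks of digits. -/

lemma shift_zero (σ : ℕ → ℕ) : shift 0 σ = σ := rfl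

lemma shift_shift (j k : ℕ) (σ : ℕ → ℕ) : shift j (shift k σ) = shift (k + j) σ := by
  funext n
  simp only [shift]
  congr 1
  ring

/-- The bound `f` must not depend on the state; this lets the lemma be iterated digit by digit with
the same weights. -/
lemma digitLaw_le_tsum {E : Set (ℕ → ℕ)} (hE : MeasurableSet E) {f : ℕ → ℝ≥0∞}
    (h : ∀ s b, digitLaw s (consDigit b ⁻¹' E) ≤ f b) (s : unitInterval) :
    digitLaw s E ≤ ∑' b : ℕ, ENNReal.ofReal (2 / ((b : ℝ) + 1) ^ 2) * f b := by
  rw [digitLaw_apply_eq_tsum s hE]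
  exact ENNReal.tsum_le_tsum fun b =>
    mul_le_mul' (ENNReal.ofReal_le_ofReal (digitWeight_le s b)) (h _ b)

lemma tsum_le_digitLaw {E : Set (ℕ → ℕ)} (hE : MeasurableSet E) {f : ℕ → ℝ≥0∞}
    (h : ∀ s b, f b ≤ digitLaw s (consDigit b ⁻¹' E)) (s : unitInterval) :
    ∑' b : ℕ, ENNReal.ofReal (1 / (3 * ((b : ℝ) + 1) ^ 2)) * f b ≤ digitLaw s E := by
  rw [digitLaw_apply_eq_tsum s hE]
  exact ENNReal.tsum_le_tsum fun b =>
    mul_le_mul' (ENNReal.ofReal_le_ofReal (le_digitWeight s b)) (h _ b)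

lemma dependsOn_consDigit_preimage {E : Set (ℕ → ℕ)} {l : ℕ} (h : DependsOn (· ∈ E) (Iio (l + 1)))
    (b : ℕ) : DependsOn (· ∈ consDigit b ⁻¹' E) (Iio l) := by
  intro σ τ hστ
  refine h fun i hi => ?_
  cases i with
  | zero => rfl
  | succ i => exact hστ i (Nat.lt_of_succ_lt_succ hi)

/-- Conditionally on the first `l` digits, an event about the later digits has at most its maximal
probability. -/
lemma digitLaw_inter_shift_le {A B : Set (ℕ → ℕ)} {l : ℕ} (hA : MeasurableSet A)
    (hB : MeasurableSet B) (hdep : DependsOn (· ∈ A) (Iio l)) {β : ℝ≥0∞}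
    (hβ : ∀ s, digitLaw s B ≤ β) (s : unitInterval) :
    digitLaw s (A ∩ shift l ⁻¹' B) ≤ digitLaw s A * β := by
  induction l generalizing A s with
  | zero =>
    have hconst (σ τ : ℕ → ℕ) : σ ∈ A ↔ τ ∈ A := by
      have := @hdep σ τ (by simp)
      exact this.to_iff
    by_cases h : (fun _ => 0) ∈ A
    · have : A = univ := eq_univ_of_forall fun τ => (hconst _ τ).1 h
      subst this
      simpa [preimage, shift_zero] using hβ s
    · have : A = ∅ := eq_empty_of_forall_notMem fun τ hτ => h ((hconst _ τ).2 hτ)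
      simp [this]
  | succ l ih =>
    rw [digitLaw_apply_eq_tsum s (hA.inter (measurable_shift _ hB)),
      digitLaw_apply_eq_tsum s hA, ← ENNReal.tsum_mul_right]
    refine ENNReal.tsum_le_tsum fun b => ?_
    rw [mul_assoc]
    exact mul_le_mul' le_rfl
      (ih (measurable_consDigit b hA) (dependsOn_consDigit_preimage hdep b) _)

lemma digitLaw_shift_le {B : Set (ℕ → ℕ)} (hB : MeasurableSet B) {β : ℝ≥0∞}
    (hβ : ∀ s, digitLaw s B ≤ β) (l : ℕ) (s : unitInterval) :
    digitLaw s (shift l ⁻¹' B) ≤ β := by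
  have h := digitLaw_inter_shift_le (l := l) MeasurableSet.univ hB
    (fun _ _ _ => by simp) hβ s
  simpa using h

lemma digitLaw_compl_le {E : Set (ℕ → ℕ)} (hE : MeasurableSet E) {p : ℝ} {s : unitInterval}
    (h : ENNReal.ofReal p ≤ digitLaw s E) : digitLaw s Eᶜ ≤ ENNReal.ofReal (1 - p) := by
  rw [prob_compl_eq_one_sub hE]
  refine (tsub_le_tsub_left h 1).trans ?_
  rcases le_or_gt 0 p with hp | hp
  · rw [ENNReal.ofReal_sub _ hp, ENNReal.ofReal_one]
  · rw [ENNReal.ofReal_of_nonpos hp.le, tsub_zero, ← ENNReal.ofReal_one]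
    exact ENNReal.ofReal_le_ofReal (by linarith)

/-- Events on consecutive blocks of digits, of probability at least `p i` regardless of the past,
all fail with probability at most `exp (-∑ p i)`. -/
lemma digitLaw_forall_notMem_le (m : ℕ) {E : ℕ → Set (ℕ → ℕ)} {l : ℕ → ℕ} {p : ℕ → ℝ}
    (hE : ∀ i, MeasurableSet (E i)) (hdep : ∀ i, DependsOn (· ∈ E i) (Iio (l i)))
    (hp : ∀ i s, ENNReal.ofReal (p i) ≤ digitLaw s (E i)) (s : unitInterval) :
    digitLaw s {σ | ∀ i < m, shift (∑ j ∈ Finset.range i, l j) σ ∉ E i} ≤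
      ENNReal.ofReal (Real.exp (-∑ i ∈ Finset.range m, p i)) := by
  induction m generalizing E l p s with
  | zero => simp
  | succ m ih =>
    set B : Set (ℕ → ℕ) :=
      {σ | ∀ i < m, shift (∑ j ∈ Finset.range i, l (j + 1)) σ ∉ E (i + 1)} with hBdef
    have hB : MeasurableSet B := by
      have : B = ⋂ i, ⋂ (_ : i < m),
          (shift (∑ j ∈ Finset.range i, l (j + 1)) ⁻¹' E (i + 1))ᶜ := by
        ext σ; simp [hBdef]
      rw [this]
      exact MeasurableSet.iInter fun i => MeasurableSet.iInter fun _ =>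
        (measurable_shift _ (hE _)).compl
    have hset : {σ | ∀ i < m + 1, shift (∑ j ∈ Finset.range i, l j) σ ∉ E i} =
        (E 0)ᶜ ∩ shift (l 0) ⁻¹' B := by
      ext σ
      simp only [mem_ofPred_eq, mem_inter_iff, mem_compl_iff, mem_preimage, hBdef, shift_shift]
      constructor
      · intro h
        refine ⟨h 0 m.succ_pos, fun i hi => ?_⟩
        have := h (i + 1) (Nat.succ_lt_succ hi)
        rwa [Finset.sum_range_succ', add_comm _ (l 0)] at this
      · rintro ⟨h0, h⟩ i hi
        cases i with
        | zero => exact h0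
        | succ i =>
          rw [Finset.sum_range_succ', add_comm _ (l 0)]
          exact h i (Nat.lt_of_succ_lt_succ hi)
    have hdepc : DependsOn (· ∈ (E 0)ᶜ) (Iio (l 0)) := fun σ τ h => by
      have := hdep 0 h
      simp only [mem_compl_iff, this]
    rw [hset]
    refine (digitLaw_inter_shift_le (hE 0).compl hB hdepc
      (ih (fun i => hE (i + 1)) (fun i => hdep (i + 1)) fun i => hp (i + 1)) s).trans ?_
    rw [Finset.sum_range_succ', neg_add, add_comm, Real.exp_add,
      ENNReal.ofReal_mul (Real.exp_nonneg _)]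
    refine mul_le_mul' ((digitLaw_compl_le (hE 0) (hp 0 s)).trans ?_) le_rfl
    refine ENNReal.ofReal_le_ofReal ?_
    linarith [Real.add_one_le_exp (-p 0)]

/-- The divergence part of the Borel–Cantelli lemma for events on consecutive blocks of digits. -/
lemma ae_frequently_shift_mem {E : ℕ → Set (ℕ → ℕ)} {l : ℕ → ℕ} {p : ℕ → ℝ}
    (hE : ∀ i, MeasurableSet (E i)) (hdep : ∀ i, DependsOn (· ∈ E i) (Iio (l i)))
    (hp0 : ∀ i, 0 ≤ p i) (hp : ∀ i s, ENNReal.ofReal (p i) ≤ digitLaw s (E i))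
    (hsum : ¬ Summable p) (s : unitInterval) :
    ∀ᵐ σ ∂digitLaw s, ∃ᶠ i in atTop, shift (∑ j ∈ Finset.range i, l j) σ ∈ E i := by
  simp only [frequently_atTop]
  refine ae_all_iff.2 fun N => ?_
  rw [ae_iff]
  -- Failure from block N on implies failure in the m blocks N, …, N+m-1; the digits before block N
  -- are discarded by `digitLaw_shift_le`.
  have hle (m : ℕ) : digitLaw s {σ | ¬ ∃ i ≥ N, shift (∑ j ∈ Finset.range i, l j) σ ∈ E i} ≤
      ENNReal.ofReal (Real.exp (-∑ i ∈ Finset.range m, p (i + N))) := by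
    set B : Set (ℕ → ℕ) :=
      {σ | ∀ i < m, shift (∑ j ∈ Finset.range i, l (j + N)) σ ∉ E (i + N)} with hBdef
    have hB : MeasurableSet B := by
      have : B = ⋂ i, ⋂ (_ : i < m),
          (shift (∑ j ∈ Finset.range i, l (j + N)) ⁻¹' E (i + N))ᶜ := by
        ext σ; simp [hBdef]
      rw [this]
      exact MeasurableSet.iInter fun i => MeasurableSet.iInter fun _ =>
        (measurable_shift _ (hE _)).compl
    refine le_trans (measure_mono ?_) (digitLaw_shift_le hB (digitLaw_forall_notMem_le m
      (fun i => hE (i + N)) (fun i => hdep (i + N)) fun i => hp (i + N))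
      (∑ j ∈ Finset.range N, l j) s)
    intro σ hσ i hi
    simp only [mem_ofPred_eq, not_exists, not_and] at hσ
    have := hσ (i + N) (Nat.le_add_left _ _)
    rw [shift_shift]
    rw [add_comm i N, Finset.sum_range_add] at this
    simpa only [add_comm N] using this
  have htend : Tendsto (fun m => ENNReal.ofReal (Real.exp (-∑ i ∈ Finset.range m, p (i + N))))
      atTop (nhds 0) := by
    rw [← ENNReal.ofReal_zero]
    refine ENNReal.tendsto_ofReal (Real.tendsto_exp_neg_atTop_nhds_zero.comp ?_)
    refine (not_summable_iff_tendsto_nat_atTop_of_nonneg fun i => hp0 _).1 ?_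
    rwa [summable_nat_add_iff N]
  exact le_antisymm (ge_of_tendsto' htend hle) zero_le

/-! ### Weighted sums of logarithmic tails. -/

/-- The weights that dominate the digit probabilities. -/
noncomputable def upperWeight (b : ℕ) : ℝ≥0∞ := ENNReal.ofReal (2 / ((b : ℝ) + 1) ^ 2)

/-- The order of magnitude of the tail of a product of `k + 1` partial quotients. -/
noncomputable def logTail (k : ℕ) (u : ℝ) : ℝ := (1 + Real.posLog u) ^ k / max 1 u

lemma logTail_nonneg (k : ℕ) (u : ℝ) : 0 ≤ logTail k u := by
  have := Real.posLog_nonneg (x := u)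
  have : 0 < max 1 u := by positivity
  unfold logTail; positivity

lemma tsum_tail_le (t : ℝ) :
    ∑' b : ℕ, ENNReal.ofReal (if t ≤ (b : ℝ) + 1 then 2 / ((b : ℝ) + 1) ^ 2 else 0) ≤
      ENNReal.ofReal (4 * logTail 0 t) := by
  have hpos : 0 < max 1 t := by positivity
  refine ENNReal.tsum_le_of_sum_range_le fun n => ?_
  rw [← ENNReal.ofReal_sum_of_nonneg fun b _ => by split_ifs <;> positivity]
  refine ENNReal.ofReal_le_ofReal ?_
  -- Telescoping with 2/(b+1)^2 ≤ 4/(b+1) - 4/(b+2); the outer maximum keeps the right side at 0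
  -- until n+1 passes `max 1 t`.
  suffices h : ∑ b ∈ Finset.range n, (if t ≤ (b : ℝ) + 1 then 2 / ((b : ℝ) + 1) ^ 2 else 0) ≤
      4 / max 1 t - 4 / max (max 1 t) ((n : ℝ) + 1) by
    refine h.trans ?_
    have : (0 : ℝ) ≤ 4 / max (max 1 t) ((n : ℝ) + 1) := by positivity
    rw [logTail, pow_zero, mul_one_div]
    linarith
  induction n with
  | zero => simp
  | succ n ih =>
    rw [Finset.sum_range_succ]
    have hn : (0 : ℝ) ≤ n := by positivity
    split_ifs with h
    · have h1 : max 1 t ≤ (n : ℝ) + 1 := max_le (by linarith) h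
      rw [max_eq_right h1] at ih
      push_cast
      rw [max_eq_right (h1.trans (by linarith))]
      have : 2 / ((n : ℝ) + 1) ^ 2 ≤ 4 / ((n : ℝ) + 1) - 4 / ((n : ℝ) + 1 + 1) := by
        rw [div_sub_div _ _ (by positivity) (by positivity),
          div_le_div_iff₀ (by positivity) (by positivity)]
        nlinarith [mul_nonneg hn hn, mul_nonneg hn (mul_nonneg hn hn)]
      linarith
    · have : 4 / max (max 1 t) (((n + 1 : ℕ) : ℝ) + 1) ≤ 4 / max (max 1 t) ((n : ℝ) + 1) := by
        gcongr
        simp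
      linarith

lemma tsum_upperWeight_ite_le (t : ℝ) :
    ∑' b : ℕ, upperWeight b * (if t ≤ (b : ℝ) + 1 then 1 else 0) ≤
      ENNReal.ofReal (4 * logTail 0 t) := by
  refine le_of_eq_of_le (tsum_congr fun b => ?_) (tsum_tail_le t)
  rw [upperWeight]
  split_ifs <;> simp

lemma tsum_harmonic_le {t c : ℝ} (ht : 1 ≤ t) (hc : 0 ≤ c) :
    ∑' b : ℕ, ENNReal.ofReal (if (b : ℝ) + 1 ≤ t then c / ((b : ℝ) + 1) else 0) ≤
      ENNReal.ofReal (c * (1 + Real.log t)) := by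
  refine ENNReal.tsum_le_of_sum_range_le fun n => ?_
  rw [← ENNReal.ofReal_sum_of_nonneg fun b _ => by split_ifs <;> positivity]
  refine ENNReal.ofReal_le_ofReal ?_
  rw [← Finset.sum_filter]
  calc ∑ b ∈ Finset.range n with ((b : ℕ) : ℝ) + 1 ≤ t, c / ((b : ℝ) + 1)
      ≤ ∑ b ∈ Finset.range ⌊t⌋₊, c / ((b : ℝ) + 1) := by
        refine Finset.sum_le_sum_of_subset_of_nonneg (fun b hb => ?_) fun b _ _ => by positivity
        rw [Finset.mem_filter] at hb
        exact Finset.mem_range.2 (Nat.le_floor (by push_cast; exact hb.2))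
    _ = c * (harmonic ⌊t⌋₊ : ℚ) := by
        simp [harmonic, Finset.mul_sum, div_eq_mul_inv]
    _ ≤ c * (1 + Real.log t) := by
        gcongr
        exact harmonic_floor_le_one_add_log t ht

lemma tsum_const_le {t c : ℝ} (ht : 0 ≤ t) (hc : 0 ≤ c) :
    ∑' b : ℕ, ENNReal.ofReal (if (b : ℝ) + 1 ≤ t then c else 0) ≤ ENNReal.ofReal (t * c) := by
  refine ENNReal.tsum_le_of_sum_range_le fun n => ?_
  rw [← ENNReal.ofReal_sum_of_nonneg fun b _ => by split_ifs <;> positivity]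
  refine ENNReal.ofReal_le_ofReal ?_
  rw [← Finset.sum_filter]
  calc ∑ b ∈ Finset.range n with ((b : ℕ) : ℝ) + 1 ≤ t, c
      ≤ ∑ b ∈ Finset.range ⌊t⌋₊, c := by
        refine Finset.sum_le_sum_of_subset_of_nonneg (fun b hb => ?_) fun b _ _ => hc
        rw [Finset.mem_filter] at hb
        exact Finset.mem_range.2 (Nat.le_floor (by push_cast; exact hb.2))
    _ = ⌊t⌋₊ * c := by simp
    _ ≤ t * c := by
        gcongr
        exact Nat.floor_le ht

/-- Split at b+1 = t: beyond it the trivial bound on `F` leaves the plain tail, and below it `G` is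
summed separately. -/
lemma tsum_upperWeight_mul_le {t B : ℝ} {F G : ℕ → ℝ} (hF : ∀ b : ℕ, t ≤ (b : ℝ) + 1 → F b ≤ 1)
    (hG : ∀ b : ℕ, (b : ℝ) + 1 ≤ t → 2 / ((b : ℝ) + 1) ^ 2 * F b ≤ G b)
    (hsum : ∑' b : ℕ, ENNReal.ofReal (if (b : ℝ) + 1 ≤ t then G b else 0) ≤ ENNReal.ofReal B)
    (hB : 0 ≤ B) :
    ∑' b : ℕ, upperWeight b * ENNReal.ofReal (F b) ≤ ENNReal.ofReal (B + 4 * logTail 0 t) := by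
  rw [ENNReal.ofReal_add hB (mul_nonneg (by norm_num) (logTail_nonneg 0 t))]
  refine le_trans ?_ (add_le_add hsum (tsum_tail_le t))
  rw [← ENNReal.tsum_add]
  refine ENNReal.tsum_le_tsum fun b => ?_
  rw [upperWeight, ← ENNReal.ofReal_mul (by positivity)]
  rcases le_or_gt ((b : ℝ) + 1) t with h | h
  · rw [if_pos h]
    exact (ENNReal.ofReal_le_ofReal (hG b h)).trans le_self_add
  · rw [if_pos h.le]
    refine (ENNReal.ofReal_le_ofReal ?_).trans le_add_self
    exact mul_le_of_le_one_right (by positivity) (hF b h.le)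

lemma logTail_of_le_one (k : ℕ) {u : ℝ} (h0 : 0 ≤ u) (h : u ≤ 1) : logTail k u = 1 := by
  rw [logTail, max_eq_left h, (Real.posLog_eq_zero_iff u).2 (by rwa [abs_of_nonneg h0])]
  simp

lemma logTail_of_one_le (k : ℕ) {u : ℝ} (h : 1 ≤ u) :
    logTail k u = (1 + Real.log u) ^ k / u := by
  rw [logTail, max_eq_right h, Real.posLog_eq_log (by rwa [abs_of_nonneg (by linarith)])]

/-- One more digit costs one more logarithm: below t the summand is at most 2(1+log t)^k/(t(b+1)), a
harmonic sum. -/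
lemma tsum_upperWeight_logTail_le (k : ℕ) {t : ℝ} (ht : 0 ≤ t) :
    ∑' b : ℕ, upperWeight b * ENNReal.ofReal (logTail k (t / ((b : ℝ) + 1))) ≤
      ENNReal.ofReal (6 * logTail (k + 1) t) := by
  have hF (b : ℕ) (h : t ≤ (b : ℝ) + 1) : logTail k (t / ((b : ℝ) + 1)) ≤ 1 :=
    (logTail_of_le_one k (by positivity) ((div_le_one (by positivity)).2 h)).le
  rcases le_or_gt 1 t with h1 | h1
  · have hl := Real.log_nonneg h1
    refine (tsum_upperWeight_mul_le (B := 2 * (1 + Real.log t) ^ k / t * (1 + Real.log t))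
      hF (G := fun b => 2 * (1 + Real.log t) ^ k / t / ((b : ℝ) + 1)) (fun b hb => ?_)
      (tsum_harmonic_le h1 (by positivity)) (by positivity)).trans (ENNReal.ofReal_le_ofReal ?_)
    · have hq : 1 ≤ t / ((b : ℝ) + 1) := (one_le_div (by positivity)).2 hb
      have hq' : t / ((b : ℝ) + 1) ≤ t := div_le_self ht (by linarith [b.cast_nonneg (α := ℝ)])
      rw [logTail_of_one_le k hq]
      calc 2 / ((b : ℝ) + 1) ^ 2 * ((1 + Real.log (t / ((b : ℝ) + 1))) ^ k / (t / ((b : ℝ) + 1)))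
          ≤ 2 / ((b : ℝ) + 1) ^ 2 * ((1 + Real.log t) ^ k / (t / ((b : ℝ) + 1))) := by
            have := Real.log_nonneg hq
            have := Real.log_le_log (zero_lt_one.trans_le hq) hq'
            gcongr
        _ = _ := by field_simp
    · rw [logTail_of_one_le _ h1, logTail_of_one_le _ h1]
      have : (1 : ℝ) ≤ (1 + Real.log t) ^ (k + 1) := one_le_pow₀ (by linarith)
      calc 2 * (1 + Real.log t) ^ k / t * (1 + Real.log t) + 4 * ((1 + Real.log t) ^ 0 / t)
          = (2 * (1 + Real.log t) ^ (k + 1) + 4) / t := by field_simp; ring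
        _ ≤ (6 * (1 + Real.log t) ^ (k + 1)) / t := by gcongr; linarith
        _ = _ := by ring
  · have h := tsum_upperWeight_mul_le (t := t) (B := 0)
      (F := fun b => logTail k (t / ((b : ℝ) + 1))) (G := 0) hF (fun b hb => ?_) ?_ le_rfl
    · refine h.trans (ENNReal.ofReal_le_ofReal ?_)
      rw [logTail_of_le_one _ ht h1.le, logTail_of_le_one _ ht h1.le]
      norm_num
    · linarith [b.cast_nonneg (α := ℝ)]
    · simp

/-- Squaring the tail cancels the weight, so at most t terms equal to 2/t^2 remain and no logarithm
is gained. -/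
lemma tsum_upperWeight_logTail_sq_le {t : ℝ} (ht : 0 ≤ t) :
    ∑' b : ℕ, upperWeight b * ENNReal.ofReal (logTail 0 (t / ((b : ℝ) + 1)) ^ 2) ≤
      ENNReal.ofReal (6 * logTail 0 t) := by
  have hF (b : ℕ) (h : t ≤ (b : ℝ) + 1) : logTail 0 (t / ((b : ℝ) + 1)) ^ 2 ≤ 1 := by
    rw [logTail_of_le_one 0 (by positivity) ((div_le_one (by positivity)).2 h), one_pow]
  have h2 : ∑' b : ℕ, ENNReal.ofReal (if (b : ℝ) + 1 ≤ t then 2 / t ^ 2 else 0) ≤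
      ENNReal.ofReal (2 * logTail 0 t) := by
    rcases le_or_gt 1 t with h1 | h1
    · refine (tsum_const_le ht (by positivity)).trans (ENNReal.ofReal_le_ofReal ?_)
      rw [logTail_of_one_le _ h1]
      refine le_of_eq ?_
      field_simp
    · have (b : ℕ) : ¬ (b : ℝ) + 1 ≤ t := by linarith [b.cast_nonneg (α := ℝ)]
      simp [this]
  refine (tsum_upperWeight_mul_le hF (fun b hb => ?_) h2
    (mul_nonneg (by norm_num) (logTail_nonneg _ _))).trans_eq (by ring_nf)
  have hq : 1 ≤ t / ((b : ℝ) + 1) := (one_le_div (by positivity)).2 hb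
  have : 0 < t := by linarith [b.cast_nonneg (α := ℝ)]
  rw [logTail_of_one_le 0 hq]
  refine le_of_eq ?_
  field_simp

lemma logTail_one_sq_le {u : ℝ} (hu : 0 ≤ u) : logTail 1 u ^ 2 ≤ 4 * logTail 0 u := by
  rcases le_or_gt 1 u with h1 | h1
  · rw [logTail_of_one_le _ h1, logTail_of_one_le _ h1]
    have hs : 0 < √u := Real.sqrt_pos.2 (by linarith)
    have hlog : Real.log u = 2 * Real.log √u := by
      rw [Real.log_sqrt hu]; ring
    have h2 := Real.log_le_sub_one_of_pos hs
    have h3 : 1 + Real.log u ≤ 2 * √u := by linarith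
    have h4 : (1 + Real.log u) ^ 2 ≤ 4 * u := by
      calc (1 + Real.log u) ^ 2 ≤ (2 * √u) ^ 2 := by
            have := Real.log_nonneg h1
            gcongr
        _ = 4 * u := by rw [mul_pow, Real.sq_sqrt hu]; norm_num
    have hu0 : 0 < u := by linarith
    rw [div_pow, pow_one, pow_zero, div_le_iff₀ (by positivity)]
    refine h4.trans_eq ?_
    field_simp
  · rw [logTail_of_le_one _ hu h1.le, logTail_of_le_one _ hu h1.le]
    norm_num

/-! ### Upper bounds for large triples and pairs of triples. -/

/-- The product of the first `k` partial quotients is at least `t`. -/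
def productSet (k : ℕ) (t : ℝ) : Set (ℕ → ℕ) := {σ | t ≤ ∏ i ∈ Finset.range k, ((σ i : ℝ) + 1)}

lemma measurableSet_productSet (k : ℕ) (t : ℝ) : MeasurableSet (productSet k t) := by
  refine measurableSet_le measurable_const (Finset.measurable_prod _ fun i _ => ?_)
  exact (measurable_from_top (f := fun m : ℕ => (m : ℝ) + 1)).comp (measurable_pi_apply i)

lemma dependsOn_productSet (k : ℕ) (t : ℝ) : DependsOn (· ∈ productSet k t) (Iio k) := by
  intro σ τ h
  have : ∏ i ∈ Finset.range k, ((σ i : ℝ) + 1) = ∏ i ∈ Finset.range k, ((τ i : ℝ) + 1) :=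
    Finset.prod_congr rfl fun i hi => by rw [h i (Finset.mem_range.1 hi)]
  simp only [productSet, mem_ofPred_eq, this]

lemma consDigit_preimage_productSet (k b : ℕ) (t : ℝ) :
    consDigit b ⁻¹' productSet (k + 1) t = productSet k (t / ((b : ℝ) + 1)) := by
  ext σ
  have hb : (0 : ℝ) < b + 1 := by positivity
  simp only [productSet, mem_preimage, mem_ofPred_eq, Finset.prod_range_succ', consDigit]
  rw [div_le_iff₀ hb]

lemma digitLaw_productSet_le (k : ℕ) {t : ℝ} (ht : 0 ≤ t) (s : unitInterval) :
    digitLaw s (productSet (k + 1) t) ≤ ENNReal.ofReal (4 * 6 ^ k * logTail k t) := by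
  induction k generalizing t s with
  | zero =>
    rw [pow_zero, mul_one]
    refine (digitLaw_le_tsum (measurableSet_productSet 1 t)
      (f := fun b => if t ≤ (b : ℝ) + 1 then 1 else 0) (fun s b => ?_) s).trans
      (tsum_upperWeight_ite_le t)
    split_ifs with h
    · exact prob_le_one
    · have : productSet 0 (t / ((b : ℝ) + 1)) = ∅ := by
        refine eq_empty_of_forall_notMem fun σ hσ => h ?_
        simp only [productSet, Finset.range_zero, Finset.prod_empty, mem_ofPred_eq] at hσ
        rwa [div_le_one (by positivity)] at hσ
      rw [consDigit_preimage_productSet, this, measure_empty]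
  | succ k ih =>
    refine (digitLaw_le_tsum (measurableSet_productSet _ t)
      (f := fun b => ENNReal.ofReal (4 * 6 ^ k) *
        ENNReal.ofReal (logTail k (t / ((b : ℝ) + 1)))) (fun s b => ?_) s).trans ?_
    · rw [consDigit_preimage_productSet, ← ENNReal.ofReal_mul (by positivity)]
      exact ih (by positivity) s
    · simp_rw [mul_left_comm _ (ENNReal.ofReal (4 * 6 ^ k))]
      rw [ENNReal.tsum_mul_left]
      refine (mul_le_mul' le_rfl (tsum_upperWeight_logTail_le k ht)).trans ?_
      rw [← ENNReal.ofReal_mul (by positivity)]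
      exact ENNReal.ofReal_le_ofReal (by ring_nf; rfl)

/-- Two triples of partial quotients that overlap in two places. -/
lemma digitLaw_overlap_two_le {t : ℝ} (ht : 0 ≤ t) (s : unitInterval) :
    digitLaw s (productSet 3 t ∩ shift 1 ⁻¹' productSet 3 t) ≤
      ENNReal.ofReal (576 * logTail 1 t) := by
  have hE : MeasurableSet (productSet 3 t ∩ shift 1 ⁻¹' productSet 3 t) :=
    (measurableSet_productSet 3 t).inter (measurable_shift 1 (measurableSet_productSet 3 t))
  set g : ℕ → ℕ → ℝ := fun b c => logTail 0 (t / ((b : ℝ) + 1) / ((c : ℝ) + 1)) with hg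
  have hg0 (b c : ℕ) : 0 ≤ g b c := logTail_nonneg _ _
  -- With b, c the shared digits, both outer digits must reach t/(bc). The first gives an indicator
  -- and the fourth a tail; summing over a innermost then squares that tail.
  have h1 : digitLaw s (productSet 3 t ∩ shift 1 ⁻¹' productSet 3 t) ≤
      ∑' a, upperWeight a * ∑' b, upperWeight b * ∑' c, upperWeight c *
        ((if t / ((b : ℝ) + 1) / ((c : ℝ) + 1) ≤ (a : ℝ) + 1 then 1 else 0) *
          ENNReal.ofReal (4 * g b c)) := by
    refine digitLaw_le_tsum hE (fun s a => digitLaw_le_tsum (measurable_consDigit a hE)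
      (fun s b => digitLaw_le_tsum (measurable_consDigit b (measurable_consDigit a hE))
      (fun s c => ?_) s) s) s
    have ha : (0 : ℝ) < a + 1 := by positivity
    have hb : (0 : ℝ) < b + 1 := by positivity
    have hc : (0 : ℝ) < c + 1 := by positivity
    split_ifs with h
    · rw [one_mul]
      refine le_trans (measure_mono ?_)
        ((digitLaw_productSet_le 0 (t := t / ((b : ℝ) + 1) / ((c : ℝ) + 1)) (by positivity) s).trans
          (by rw [pow_zero, mul_one]))
      rintro σ ⟨-, hσ⟩
      simp only [productSet, mem_preimage, mem_ofPred_eq, Finset.prod_range_succ,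
        Finset.prod_range_zero, shift, consDigit, one_mul, zero_add] at hσ ⊢
      rw [div_div, div_le_iff₀ (by positivity)]
      linarith
    · have : consDigit c ⁻¹' (consDigit b ⁻¹' (consDigit a ⁻¹'
          (productSet 3 t ∩ shift 1 ⁻¹' productSet 3 t))) = ∅ := by
        refine eq_empty_of_forall_notMem fun σ hσ => h ?_
        have hσ := hσ.1
        simp only [productSet, mem_ofPred_eq, Finset.prod_range_succ,
          Finset.prod_range_zero, consDigit, one_mul] at hσ
        rw [div_div, div_le_iff₀ (by positivity)]
        linarith
      rw [this, measure_empty, zero_mul]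
  have h2 (b c : ℕ) : (∑' a, upperWeight a *
      ((if t / ((b : ℝ) + 1) / ((c : ℝ) + 1) ≤ (a : ℝ) + 1 then 1 else 0) *
          ENNReal.ofReal (4 * g b c))) ≤ ENNReal.ofReal 16 * ENNReal.ofReal (g b c ^ 2) := by
    simp_rw [← mul_assoc]
    rw [ENNReal.tsum_mul_right]
    refine (mul_le_mul' (tsum_upperWeight_ite_le _) le_rfl).trans ?_
    rw [← ENNReal.ofReal_mul (mul_nonneg (by norm_num) (hg0 b c)),
      ← ENNReal.ofReal_mul (by norm_num)]
    exact ENNReal.ofReal_le_ofReal (by simp only [hg]; ring_nf; rfl)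
  refine h1.trans ?_
  calc ∑' a, upperWeight a * ∑' b, upperWeight b * ∑' c, upperWeight c *
        ((if t / ((b : ℝ) + 1) / ((c : ℝ) + 1) ≤ (a : ℝ) + 1 then 1 else 0) *
          ENNReal.ofReal (4 * g b c))
      = ∑' b, upperWeight b * ∑' c, upperWeight c * ∑' a, upperWeight a *
        ((if t / ((b : ℝ) + 1) / ((c : ℝ) + 1) ≤ (a : ℝ) + 1 then 1 else 0) *
          ENNReal.ofReal (4 * g b c)) := by
        simp_rw [← ENNReal.tsum_mul_left]
        rw [ENNReal.tsum_comm]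
        refine tsum_congr fun b => ?_
        rw [ENNReal.tsum_comm]
        exact tsum_congr fun c => tsum_congr fun a => by ring
    _ ≤ ∑' b, upperWeight b * ∑' c, upperWeight c *
          (ENNReal.ofReal 16 * ENNReal.ofReal (g b c ^ 2)) := by
        gcongr with b c
        exact h2 b c
    _ ≤ ∑' b, upperWeight b *
          (ENNReal.ofReal 16 * ENNReal.ofReal (6 * logTail 0 (t / ((b : ℝ) + 1)))) := by
        gcongr with b
        simp_rw [mul_left_comm _ (ENNReal.ofReal 16)]
        rw [ENNReal.tsum_mul_left]
        gcongr
        exact tsum_upperWeight_logTail_sq_le (by positivity)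
    _ = ENNReal.ofReal 96 * ∑' b, upperWeight b *
          ENNReal.ofReal (logTail 0 (t / ((b : ℝ) + 1))) := by
        rw [← ENNReal.tsum_mul_left]
        refine tsum_congr fun b => ?_
        rw [ENNReal.ofReal_mul (by norm_num), ← mul_assoc (ENNReal.ofReal 16),
          ← ENNReal.ofReal_mul (by norm_num), mul_left_comm]
        norm_num
    _ ≤ ENNReal.ofReal 96 * ENNReal.ofReal (6 * logTail 1 t) := by
        gcongr
        exact tsum_upperWeight_logTail_le 0 ht
    _ = ENNReal.ofReal (576 * logTail 1 t) := by
        rw [← ENNReal.ofReal_mul (by norm_num)]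
        congr 1
        ring

/-- Two triples of partial quotients that overlap in one place. -/
lemma digitLaw_overlap_one_le {t : ℝ} (ht : 0 ≤ t) (s : unitInterval) :
    digitLaw s (productSet 3 t ∩ shift 2 ⁻¹' productSet 3 t) ≤
      ENNReal.ofReal (13824 * logTail 1 t) := by
  have hE : MeasurableSet (productSet 3 t ∩ shift 2 ⁻¹' productSet 3 t) :=
    (measurableSet_productSet 3 t).inter (measurable_shift 2 (measurableSet_productSet 3 t))
  set g : ℕ → ℝ := fun c => logTail 1 (t / ((c : ℝ) + 1)) with hg
  have hg0 (c : ℕ) : 0 ≤ g c := logTail_nonneg _ _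
  -- Only c is shared: the two digits before it and the two after it must each have product at least
  -- t/c. The resulting square of `logTail 1` is absorbed into `logTail 0` before summing over c.
  have h1 : digitLaw s (productSet 3 t ∩ shift 2 ⁻¹' productSet 3 t) ≤
      ∑' a, upperWeight a * ∑' b, upperWeight b * ∑' c, upperWeight c *
        ((if t / ((c : ℝ) + 1) / ((a : ℝ) + 1) ≤ (b : ℝ) + 1 then 1 else 0) *
          ENNReal.ofReal (24 * g c)) := by
    refine digitLaw_le_tsum hE (fun s a => digitLaw_le_tsum (measurable_consDigit a hE)
      (fun s b => digitLaw_le_tsum (measurable_consDigit b (measurable_consDigit a hE))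
      (fun s c => ?_) s) s) s
    have ha : (0 : ℝ) < a + 1 := by positivity
    have hb : (0 : ℝ) < b + 1 := by positivity
    have hc : (0 : ℝ) < c + 1 := by positivity
    split_ifs with h
    · rw [one_mul]
      refine le_trans (measure_mono ?_)
        ((digitLaw_productSet_le 1 (t := t / ((c : ℝ) + 1)) (by positivity) s).trans
          (by norm_num [hg]))
      rintro σ ⟨-, hσ⟩
      simp only [productSet, mem_preimage, mem_ofPred_eq, Finset.prod_range_succ,
        Finset.prod_range_zero, shift, consDigit, one_mul] at hσ ⊢
      rw [div_le_iff₀ (by positivity)]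
      linarith
    · have : consDigit c ⁻¹' (consDigit b ⁻¹' (consDigit a ⁻¹'
          (productSet 3 t ∩ shift 2 ⁻¹' productSet 3 t))) = ∅ := by
        refine eq_empty_of_forall_notMem fun σ hσ => h ?_
        have hσ := hσ.1
        simp only [productSet, mem_ofPred_eq, Finset.prod_range_succ,
          Finset.prod_range_zero, consDigit, one_mul] at hσ
        rw [div_div, div_le_iff₀ (by positivity)]
        linarith
      rw [this, measure_empty, zero_mul]
  have h2 (c : ℕ) : (∑' a, upperWeight a * ∑' b, upperWeight b *
      ((if t / ((c : ℝ) + 1) / ((a : ℝ) + 1) ≤ (b : ℝ) + 1 then 1 else 0) *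
          ENNReal.ofReal (24 * g c))) ≤
      ENNReal.ofReal 2304 * ENNReal.ofReal (logTail 0 (t / ((c : ℝ) + 1))) := by
    simp_rw [← mul_assoc, ENNReal.tsum_mul_right, ← mul_assoc]
    rw [ENNReal.tsum_mul_right]
    have h3 : ∑' a : ℕ, upperWeight a * ∑' b : ℕ, upperWeight b *
        (if t / ((c : ℝ) + 1) / ((a : ℝ) + 1) ≤ (b : ℝ) + 1 then 1 else 0) ≤
        ENNReal.ofReal (24 * g c) := by
      calc _ ≤ ∑' a : ℕ, upperWeight a *
            ENNReal.ofReal (4 * logTail 0 (t / ((c : ℝ) + 1) / ((a : ℝ) + 1))) := by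
            gcongr with a
            exact tsum_upperWeight_ite_le _
        _ = ENNReal.ofReal 4 * ∑' a : ℕ, upperWeight a *
            ENNReal.ofReal (logTail 0 (t / ((c : ℝ) + 1) / ((a : ℝ) + 1))) := by
            rw [← ENNReal.tsum_mul_left]
            refine tsum_congr fun b => ?_
            rw [ENNReal.ofReal_mul (by norm_num), mul_left_comm]
        _ ≤ ENNReal.ofReal 4 * ENNReal.ofReal (6 * g c) := by
            gcongr
            exact tsum_upperWeight_logTail_le 0 (by positivity)
        _ = ENNReal.ofReal (24 * g c) := by
            rw [← ENNReal.ofReal_mul (by norm_num)]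
            congr 1
            ring
    refine (mul_le_mul' h3 le_rfl).trans ?_
    rw [← ENNReal.ofReal_mul (mul_nonneg (by norm_num) (hg0 c)),
      ← ENNReal.ofReal_mul (by norm_num)]
    refine ENNReal.ofReal_le_ofReal ?_
    have := logTail_one_sq_le (u := t / ((c : ℝ) + 1)) (by positivity)
    simp only [hg]
    linarith
  refine h1.trans ?_
  calc ∑' a, upperWeight a * ∑' b, upperWeight b * ∑' c, upperWeight c *
        ((if t / ((c : ℝ) + 1) / ((a : ℝ) + 1) ≤ (b : ℝ) + 1 then 1 else 0) *
          ENNReal.ofReal (24 * g c))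
      = ∑' c, upperWeight c * ∑' a, upperWeight a * ∑' b, upperWeight b *
        ((if t / ((c : ℝ) + 1) / ((a : ℝ) + 1) ≤ (b : ℝ) + 1 then 1 else 0) *
          ENNReal.ofReal (24 * g c)) := by
        simp_rw [← ENNReal.tsum_mul_left]
        symm
        rw [ENNReal.tsum_comm]
        refine tsum_congr fun a => ?_
        rw [ENNReal.tsum_comm]
        exact tsum_congr fun b => tsum_congr fun c => by ring
    _ ≤ ∑' c, upperWeight c *
          (ENNReal.ofReal 2304 * ENNReal.ofReal (logTail 0 (t / ((c : ℝ) + 1)))) := by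
        gcongr with c
        exact h2 c
    _ = ENNReal.ofReal 2304 * ∑' c, upperWeight c *
          ENNReal.ofReal (logTail 0 (t / ((c : ℝ) + 1))) := by
        rw [← ENNReal.tsum_mul_left]
        exact tsum_congr fun c => mul_left_comm _ _ _
    _ ≤ ENNReal.ofReal 2304 * ENNReal.ofReal (6 * logTail 1 t) := by
        gcongr
        exact tsum_upperWeight_logTail_le 0 ht
    _ = ENNReal.ofReal (13824 * logTail 1 t) := by
        rw [← ENNReal.ofReal_mul (by norm_num)]
        congr 1
        ring

/-- Two triples of partial quotients that do not overlap. -/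
lemma digitLaw_disjoint_le {t : ℝ} (ht : 0 ≤ t) {k : ℕ} (hk : 3 ≤ k) (s : unitInterval) :
    digitLaw s (productSet 3 t ∩ shift k ⁻¹' productSet 3 t) ≤
      ENNReal.ofReal (20736 * logTail 2 t ^ 2) := by
  refine (digitLaw_inter_shift_le (measurableSet_productSet 3 t) (measurableSet_productSet 3 t)
    (fun σ τ h => dependsOn_productSet 3 t fun i hi => h i (hi.trans_le hk))
    (digitLaw_productSet_le 2 ht) s).trans ?_
  refine (mul_le_mul' (digitLaw_productSet_le 2 ht s) le_rfl).trans ?_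
  rw [← ENNReal.ofReal_mul (mul_nonneg (by norm_num) (logTail_nonneg _ _))]
  exact ENNReal.ofReal_le_ofReal (by ring_nf; rfl)

/-! ### Lower bounds for large triples. -/

lemma le_digitLaw_inter_shift {A B : Set (ℕ → ℕ)} {l : ℕ} (hA : MeasurableSet A)
    (hB : MeasurableSet B) (hdep : DependsOn (· ∈ A) (Iio l)) {q : ℝ} (hq0 : 0 ≤ q) (hq1 : q ≤ 1)
    (hq : ∀ s, ENNReal.ofReal q ≤ digitLaw s B) (s : unitInterval) :
    digitLaw s A * ENNReal.ofReal q ≤ digitLaw s (A ∩ shift l ⁻¹' B) := by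
  -- The lower bound comes from the upper bound 1-q for the complement of `B`.
  have h1 := digitLaw_inter_shift_le hA hB.compl hdep (fun s => digitLaw_compl_le hB (hq s)) s
  have h2 := measure_inter_add_sdiff (μ := digitLaw s) A (measurable_shift l hB)
  rw [sdiff_eq, ← preimage_compl] at h2
  have h3 : digitLaw s A * ENNReal.ofReal q + digitLaw s A * ENNReal.ofReal (1 - q) =
      digitLaw s A := by
    rw [← mul_add, ← ENNReal.ofReal_add hq0 (by linarith)]
    simp
  refine ENNReal.le_of_add_le_add_right (a := digitLaw s A * ENNReal.ofReal (1 - q))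
    (ENNReal.mul_ne_top (measure_ne_top (digitLaw s) A) ENNReal.ofReal_ne_top) ?_
  rw [h3]
  exact h2.symm.le.trans (add_le_add le_rfl h1)

lemma le_tsum_tail {t : ℝ} (ht : 1 ≤ t) :
    ENNReal.ofReal (1 / 24 / t) ≤ ∑' b : ℕ, ENNReal.ofReal (1 / (3 * ((b : ℝ) + 1) ^ 2)) *
      (if t ≤ (b : ℝ) + 1 then 1 else 0) := by
  -- With m = ⌈t⌉ ≤ 2t, the m terms from m to 2m-1 are each at least 1/(12m^2).
  refine le_trans ?_ (ENNReal.sum_le_tsum (Finset.Ico ⌈t⌉₊ (2 * ⌈t⌉₊)))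
  have hm1 := Nat.le_ceil t
  have hm2 := Nat.ceil_lt_add_one (zero_le_one.trans ht)
  set m := ⌈t⌉₊
  have hm : (0 : ℝ) < m := by linarith
  have hterm : ∀ b ∈ Finset.Ico m (2 * m), ENNReal.ofReal (1 / (12 * (m : ℝ) ^ 2)) ≤
      ENNReal.ofReal (1 / (3 * ((b : ℝ) + 1) ^ 2)) * (if t ≤ (b : ℝ) + 1 then 1 else 0) := by
    intro b hb
    rw [Finset.mem_Ico] at hb
    have hb1 : (m : ℝ) ≤ b := by exact_mod_cast hb.1
    have hb2 : (b : ℝ) + 1 ≤ 2 * m := by exact_mod_cast hb.2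
    rw [if_pos (by linarith), mul_one]
    refine ENNReal.ofReal_le_ofReal (one_div_le_one_div_of_le (by positivity) ?_)
    calc 3 * ((b : ℝ) + 1) ^ 2 ≤ 3 * (2 * m) ^ 2 := by gcongr
      _ = 12 * (m : ℝ) ^ 2 := by ring
  refine le_trans ?_ (Finset.sum_le_sum hterm)
  rw [Finset.sum_const, Nat.card_Ico, two_mul, Nat.add_sub_cancel, ← ENNReal.ofReal_nsmul,
    nsmul_eq_mul]
  refine ENNReal.ofReal_le_ofReal ?_
  have : (m : ℝ) * (1 / (12 * (m : ℝ) ^ 2)) = 1 / (12 * m) := by field_simp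
  rw [this, div_div]
  exact one_div_le_one_div_of_le (by positivity) (by linarith)

/-- Only first digits up to √t are kept: the remaining threshold is then at least √t, whose
logarithm is (log t)/2, and the harmonic sum up to √t supplies the next factor (log t)/2. -/
lemma exists_le_digitLaw_productSet (k : ℕ) : ∃ c : ℝ, 0 < c ∧ ∀ t, 1 ≤ t → ∀ s,
    ENNReal.ofReal (c * (Real.log t ^ k / t)) ≤ digitLaw s (productSet (k + 1) t) := by
  induction k with
  | zero =>
    refine ⟨1 / 24, by norm_num, fun t ht s => ?_⟩
    rw [pow_zero, mul_one_div]
    refine (le_tsum_tail ht).trans (tsum_le_digitLaw (measurableSet_productSet 1 t)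
      (fun s b => ?_) s)
    split_ifs with h
    · have : productSet 0 (t / ((b : ℝ) + 1)) = univ := by
        refine eq_univ_of_forall fun σ => ?_
        simp only [productSet, Finset.range_zero, Finset.prod_empty, mem_ofPred_eq]
        rwa [div_le_one (by positivity)]
      rw [consDigit_preimage_productSet, this, measure_univ]
    · exact zero_le
  | succ k ih =>
    obtain ⟨c, hc, h⟩ := ih
    refine ⟨c / (3 * 2 ^ (k + 1)), by positivity, fun t ht s => ?_⟩
    have hl := Real.log_nonneg ht
    have ht0 : 0 < t := by linarith
    set N := ⌊√t⌋₊ with hN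
    set f : ℕ → ℝ≥0∞ := fun b =>
      if b < N then ENNReal.ofReal (c * ((Real.log t / 2) ^ k / (t / ((b : ℝ) + 1)))) else 0
      with hf
    refine le_trans ?_ (tsum_le_digitLaw (measurableSet_productSet (k + 2) t) (f := f)
      (fun s b => ?_) s)
    · refine le_trans ?_ (ENNReal.sum_le_tsum (Finset.range N))
      have : ∀ b ∈ Finset.range N, ENNReal.ofReal (1 / (3 * ((b : ℝ) + 1) ^ 2)) * f b =
          ENNReal.ofReal (c * (Real.log t / 2) ^ k / (3 * t) * (1 / ((b : ℝ) + 1))) := by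
        intro b hb
        rw [hf]
        simp only [if_pos (Finset.mem_range.1 hb)]
        rw [← ENNReal.ofReal_mul (by positivity)]
        congr 1
        field_simp
      rw [Finset.sum_congr rfl this, ← ENNReal.ofReal_sum_of_nonneg fun b _ => by positivity,
        ← Finset.mul_sum]
      refine ENNReal.ofReal_le_ofReal ?_
      have h1 : Real.log t / 2 ≤ ∑ b ∈ Finset.range N, 1 / ((b : ℝ) + 1) := by
        calc Real.log t / 2 = Real.log √t := (Real.log_sqrt ht0.le).symm
          _ ≤ Real.log ((N + 1 : ℕ) : ℝ) := by
            refine Real.log_le_log (Real.sqrt_pos.2 ht0) ?_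
            push_cast
            exact (Nat.lt_floor_add_one _).le
          _ ≤ (harmonic N : ℚ) := log_add_one_le_harmonic N
          _ = _ := by simp [harmonic]
      calc c / (3 * 2 ^ (k + 1)) * (Real.log t ^ (k + 1) / t)
          = c * (Real.log t / 2) ^ k / (3 * t) * (Real.log t / 2) := by
            rw [div_pow]; field_simp; ring
        _ ≤ _ := by gcongr
    · rw [hf]
      beta_reduce
      split_ifs with hb
      · rw [consDigit_preimage_productSet]
        have hb1 : (b : ℝ) + 1 ≤ √t := by
          have : ((b + 1 : ℕ) : ℝ) ≤ √t := (Nat.le_floor_iff (Real.sqrt_nonneg t)).1 hb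
          exact_mod_cast this
        have hsq : √t ≤ t / ((b : ℝ) + 1) := by
          rw [le_div_iff₀ (by positivity)]
          calc √t * ((b : ℝ) + 1) ≤ √t * √t := by gcongr
            _ = t := Real.mul_self_sqrt ht0.le
        have h1 : 1 ≤ √t := Real.one_le_sqrt.2 ht
        refine le_trans (ENNReal.ofReal_le_ofReal ?_) (h _ (h1.trans hsq) s)
        gcongr
        rw [← Real.log_sqrt ht0.le]
        exact Real.log_le_log (by linarith) hsq
      · exact zero_le

/-- One of the first `m` disjoint triples has product at least `t`. -/
def someTripleSet (m : ℕ) (t : ℝ) : Set (ℕ → ℕ) := {σ | ∃ i < m, shift (i * 3) σ ∈ productSet 3 t}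

lemma measurableSet_someTripleSet (m : ℕ) (t : ℝ) : MeasurableSet (someTripleSet m t) := by
  have : someTripleSet m t = ⋃ i, ⋃ (_ : i < m), shift (i * 3) ⁻¹' productSet 3 t := by
    ext σ; simp [someTripleSet]
  rw [this]
  exact MeasurableSet.iUnion fun i => MeasurableSet.iUnion fun _ =>
    measurable_shift _ (measurableSet_productSet 3 t)

lemma dependsOn_someTripleSet (m : ℕ) (t : ℝ) :
    DependsOn (· ∈ someTripleSet m t) (Iio (3 * m)) := by
  intro σ τ h
  simp only [someTripleSet, mem_ofPred_eq, eq_iff_iff]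
  refine exists_congr fun i => and_congr_right fun hi => ?_
  refine (dependsOn_productSet 3 t fun j hj => h (j + i * 3) ?_).to_iff
  rw [mem_Iio] at hj ⊢
  omega

lemma half_min_le_one_sub_exp {x : ℝ} (hx : 0 ≤ x) : min 1 x / 2 ≤ 1 - Real.exp (-x) := by
  have h1 : Real.exp (-x) ≤ 1 / (1 + x) := by
    rw [Real.exp_neg, ← one_div]
    exact one_div_le_one_div_of_le (by positivity) (by linarith [Real.add_one_le_exp x])
  have h2 : 1 - 1 / (1 + x) = x / (1 + x) := by field_simp; ring
  have h3 : min 1 x / 2 ≤ x / (1 + x) := by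
    rw [div_le_div_iff₀ (by norm_num) (by positivity)]
    rcases le_total 1 x with h | h
    · rw [min_eq_left h]; linarith
    · rw [min_eq_right h]; nlinarith
  linarith

lemma le_digitLaw_someTripleSet {m : ℕ} {t p : ℝ} (hp0 : 0 ≤ p)
    (hp : ∀ s, ENNReal.ofReal p ≤ digitLaw s (productSet 3 t)) (s : unitInterval) :
    ENNReal.ofReal (min 1 (m * p) / 2) ≤ digitLaw s (someTripleSet m t) := by
  have h := digitLaw_forall_notMem_le m (E := fun _ => productSet 3 t) (l := fun _ => 3)
    (p := fun _ => p) (fun _ => measurableSet_productSet 3 t)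
    (fun _ => dependsOn_productSet 3 t) (fun _ => hp) s
  have hset : {σ : ℕ → ℕ | ∀ i < m, shift (∑ j ∈ Finset.range i, 3) σ ∉ productSet 3 t} =
      (someTripleSet m t)ᶜ := by
    ext σ; simp [someTripleSet]
  rw [hset, Finset.sum_const, Finset.card_range, nsmul_eq_mul,
    prob_compl_eq_one_sub (measurableSet_someTripleSet m t), tsub_le_iff_left] at h
  have h1 : ENNReal.ofReal (min 1 (m * p) / 2) + ENNReal.ofReal (Real.exp (-(m * p))) ≤
      digitLaw s (someTripleSet m t) + ENNReal.ofReal (Real.exp (-(m * p))) := by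
    refine le_trans ?_ h
    rw [← ENNReal.ofReal_add (by positivity) (Real.exp_nonneg _), ENNReal.ofReal_le_one]
    linarith [half_min_le_one_sub_exp (x := m * p) (by positivity)]
  exact ENNReal.le_of_add_le_add_right ENNReal.ofReal_ne_top h1

/-- Each of the first two blocks of `m` disjoint triples has a triple with product at least `t`. -/
def twoTriplesSet (m : ℕ) (t : ℝ) : Set (ℕ → ℕ) :=
  someTripleSet m t ∩ shift (3 * m) ⁻¹' someTripleSet m t

lemma measurableSet_twoTriplesSet (m : ℕ) (t : ℝ) : MeasurableSet (twoTriplesSet m t) :=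
  (measurableSet_someTripleSet m t).inter
    (measurable_shift _ (measurableSet_someTripleSet m t))

lemma dependsOn_twoTriplesSet (m : ℕ) (t : ℝ) :
    DependsOn (· ∈ twoTriplesSet m t) (Iio (6 * m)) := by
  intro σ τ h
  simp only [twoTriplesSet, mem_inter_iff, mem_preimage, eq_iff_iff]
  refine and_congr (dependsOn_someTripleSet m t fun i hi => h i ?_).to_iff
    (dependsOn_someTripleSet m t fun i hi => h (i + 3 * m) ?_).to_iff
  all_goals
    rw [mem_Iio] at hi ⊢
    omega

lemma le_digitLaw_twoTriplesSet {m : ℕ} {t p : ℝ} (hp0 : 0 ≤ p)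
    (hp : ∀ s, ENNReal.ofReal p ≤ digitLaw s (productSet 3 t)) (s : unitInterval) :
    ENNReal.ofReal ((min 1 (m * p) / 2) ^ 2) ≤ digitLaw s (twoTriplesSet m t) := by
  have h0 : 0 ≤ min 1 (m * p) / 2 := by positivity
  have h1 : min 1 (m * p) / 2 ≤ 1 := by linarith [min_le_left 1 (m * p)]
  refine le_trans ?_ (le_digitLaw_inter_shift (measurableSet_someTripleSet m t)
    (measurableSet_someTripleSet m t) (dependsOn_someTripleSet m t) h0 h1
    (le_digitLaw_someTripleSet hp0 hp) s)
  rw [sq, ENNReal.ofReal_mul h0]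
  exact mul_le_mul' (le_digitLaw_someTripleSet hp0 hp s) le_rfl

/-! ### The limsup set of digit sequences and its Lebesgue measure. -/

/-- The digit sequences such that, for infinitely many `n`, two triples that start before the
`n`-th digit have products at least `φ n`. -/
def largeTripleSet (φ : ℕ → ℝ) : Set (ℕ → ℕ) :=
  {σ | ∃ᶠ n in atTop, ∃ j k : ℕ, j < k ∧ k < n ∧
    shift j σ ∈ productSet 3 (φ n) ∧ shift k σ ∈ productSet 3 (φ n)}

lemma measurableSet_largeTripleSet (φ : ℕ → ℝ) : MeasurableSet (largeTripleSet φ) := by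
  have : largeTripleSet φ = ⋂ N : ℕ, ⋃ n : ℕ, ⋃ (_ : N ≤ n), ⋃ j : ℕ, ⋃ k : ℕ, ⋃ (_ : j < k),
      ⋃ (_ : k < n), (shift j ⁻¹' productSet 3 (φ n) ∩ shift k ⁻¹' productSet 3 (φ n)) := by
    ext σ
    simp only [largeTripleSet, frequently_atTop, mem_ofPred_eq, mem_iInter, mem_iUnion,
      mem_inter_iff, mem_preimage, exists_prop]
  rw [this]
  refine MeasurableSet.iInter fun N => MeasurableSet.iUnion fun n => MeasurableSet.iUnion fun _ =>
    MeasurableSet.iUnion fun j => MeasurableSet.iUnion fun k => MeasurableSet.iUnion fun _ =>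
    MeasurableSet.iUnion fun _ => ?_
  exact (measurable_shift _ (measurableSet_productSet 3 _)).inter
    (measurable_shift _ (measurableSet_productSet 3 _))

lemma le_blockProduct_iff {x : ℝ} (hx : Irrational x) (h : x ∈ Ico (0 : ℝ) 1) (l j : ℕ) (t : ℝ) :
    t ≤ blockProduct l x (j + 1) ↔ shift j (digits x) ∈ productSet l t := by
  have : blockProduct l x (j + 1) = ∏ i ∈ Finset.range l, ((shift j (digits x) i : ℝ) + 1) := by
    refine Finset.prod_congr rfl fun i _ => ?_
    rw [show j + 1 + i = (i + j) + 1 by ring, partialQuotient_succ hx h]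
    rfl
  rw [this, productSet, mem_ofPred_eq]

lemma largeProductSet_eq (φ : ℕ → ℝ) :
    largeProductSet 3 φ = Ico 0 1 ∩ {x | Irrational x} ∩ digits ⁻¹' largeTripleSet φ := by
  ext x
  simp only [largeProductSet, largeTripleSet, mem_ofPred_eq, mem_inter_iff, mem_preimage,
    and_assoc]
  refine and_congr_right fun h => and_congr_right fun hx => ?_
  refine frequently_congr (Eventually.of_forall fun n => ?_)
  constructor
  · rintro ⟨j, k, hj, hjk, hk, h1, h2⟩
    obtain ⟨j, rfl⟩ := Nat.exists_eq_add_of_le' hj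
    obtain ⟨k, rfl⟩ := Nat.exists_eq_add_of_le' (hj.trans hjk.le)
    exact ⟨j, k, by omega, by omega, (le_blockProduct_iff hx h 3 j _).1 h1,
      (le_blockProduct_iff hx h 3 k _).1 h2⟩
  · rintro ⟨j, k, hjk, hk, h1, h2⟩
    exact ⟨j + 1, k + 1, by omega, by omega, by omega, (le_blockProduct_iff hx h 3 j _).2 h1,
      (le_blockProduct_iff hx h 3 k _).2 h2⟩

lemma measurableSet_irrational : MeasurableSet {x : ℝ | Irrational x} :=
  (countable_range ((↑) : ℚ → ℝ)).measurableSet.compl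

lemma measurableSet_largeProductSet (φ : ℕ → ℝ) : MeasurableSet (largeProductSet 3 φ) := by
  rw [largeProductSet_eq]
  exact (measurableSet_Ico.inter measurableSet_irrational).inter
    (measurable_digits (measurableSet_largeTripleSet φ))

lemma volume_largeProductSet (φ : ℕ → ℝ) :
    volume (largeProductSet 3 φ) = digitLaw 0 (largeTripleSet φ) := by
  rw [digitLaw_zero, Measure.map_apply measurable_digits (measurableSet_largeTripleSet φ),
    Measure.restrict_apply (measurable_digits (measurableSet_largeTripleSet φ)),
    largeProductSet_eq]
  refine measure_congr ?_
  have : {x : ℝ | Irrational x} =ᵐ[volume] (univ : Set ℝ) :=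
    eventuallyEq_univ.2 ((countable_range ((↑) : ℚ → ℝ)).ae_notMem volume)
  have h := ((ae_eq_refl (Ico (0 : ℝ) 1)).inter this).inter
    (ae_eq_refl (μ := volume) (digits ⁻¹' largeTripleSet φ))
  rwa [inter_univ, inter_comm _ (digits ⁻¹' _), inter_comm _ (digits ⁻¹' _),
    inter_comm (digits ⁻¹' _) (Ico 0 1 ∩ _)] at h

/-! ### The convergence half. -/

lemma half_le_log {t : ℝ} (ht : 2 ≤ t) : 1 / 2 ≤ Real.log t := by
  have := Real.log_two_gt_d9
  have := Real.log_le_log (by norm_num) ht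
  linarith

lemma logTail_one_le {t : ℝ} (ht : 2 ≤ t) : logTail 1 t ≤ 3 * (Real.log t / t) := by
  rw [logTail_of_one_le _ (by linarith), pow_one, ← mul_div_assoc]
  have := half_le_log ht
  gcongr
  linarith

lemma logTail_two_sq_le {t : ℝ} (ht : 2 ≤ t) :
    logTail 2 t ^ 2 ≤ 81 * (Real.log t ^ 4 / t ^ 2) := by
  have := half_le_log ht
  rw [logTail_of_one_le _ (by linarith), div_pow, ← mul_div_assoc]
  gcongr
  calc ((1 + Real.log t) ^ 2) ^ 2 ≤ ((3 * Real.log t) ^ 2) ^ 2 := by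
        gcongr
        linarith
    _ = _ := by ring

/-- The gap is d+1, so d = 0, 1 are the overlapping cases. The constants are 81·20736 and 3·13824.
-/
lemma digitLaw_pair_le {t : ℝ} (ht : 2 ≤ t) (d : ℕ) (s : unitInterval) :
    digitLaw s (productSet 3 t ∩ shift (d + 1) ⁻¹' productSet 3 t) ≤
      ENNReal.ofReal (1679616 * (Real.log t ^ 4 / t ^ 2) +
        if d < 2 then 41472 * (Real.log t / t) else 0) := by
  have h0 : 0 ≤ t := by linarith
  have h1 := logTail_one_le ht
  have h2 := logTail_two_sq_le ht
  have h3 : 0 ≤ Real.log t ^ 4 / t ^ 2 := by positivity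
  have h4 : 0 ≤ Real.log t / t := div_nonneg (Real.log_nonneg (by linarith)) h0
  rcases d with _ | _ | d
  · refine (digitLaw_overlap_two_le h0 s).trans (ENNReal.ofReal_le_ofReal ?_)
    simp only [Nat.ofNat_pos, if_true]
    linarith
  · refine (digitLaw_overlap_one_le h0 s).trans (ENNReal.ofReal_le_ofReal ?_)
    simp only [Nat.one_lt_ofNat, zero_add, if_true]
    linarith
  · refine (digitLaw_disjoint_le h0 (by omega) s).trans (ENNReal.ofReal_le_ofReal ?_)
    rw [if_neg (by omega)]
    linarith

/-- The event that a triple starting at the digit `n` and an earlier one are large. -/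
def pairSet (t : ℝ) (n : ℕ) : Set (ℕ → ℕ) :=
  {σ | ∃ j < n, shift j σ ∈ productSet 3 t ∧ shift n σ ∈ productSet 3 t}

lemma digitLaw_pairSet_le {t : ℝ} (ht : 2 ≤ t) (n : ℕ) (s : unitInterval) :
    digitLaw s (pairSet t n) ≤ ENNReal.ofReal
      (1679616 * ((n + 1 : ℕ) * Real.log t ^ 4 / t ^ 2 + Real.log t / t)) := by
  have h0 : 0 ≤ t := by linarith
  have h3 : 0 ≤ Real.log t ^ 4 / t ^ 2 := by positivity
  have h4 : 0 ≤ Real.log t / t := div_nonneg (Real.log_nonneg (by linarith)) h0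
  have hsub : pairSet t n ⊆ ⋃ d ∈ Finset.range n,
      shift (n - 1 - d) ⁻¹' (productSet 3 t ∩ shift (d + 1) ⁻¹' productSet 3 t) := by
    rintro σ ⟨j, hj, h1, h2⟩
    simp only [mem_iUnion, Finset.mem_range]
    refine ⟨n - 1 - j, by omega, ?_⟩
    rw [mem_preimage, show n - 1 - (n - 1 - j) = j by omega, mem_inter_iff, mem_preimage,
      shift_shift, show j + (n - 1 - j + 1) = n by omega]
    exact ⟨h1, h2⟩
  calc digitLaw s (pairSet t n) ≤ ∑ d ∈ Finset.range n, digitLaw s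
        (shift (n - 1 - d) ⁻¹' (productSet 3 t ∩ shift (d + 1) ⁻¹' productSet 3 t)) :=
        (measure_mono hsub).trans (measure_biUnion_finset_le _ _)
    _ ≤ ∑ d ∈ Finset.range n, ENNReal.ofReal (1679616 * (Real.log t ^ 4 / t ^ 2) +
        if d < 2 then 41472 * (Real.log t / t) else 0) := by
        refine Finset.sum_le_sum fun d _ => digitLaw_shift_le
          ((measurableSet_productSet 3 t).inter
            (measurable_shift _ (measurableSet_productSet 3 t))) (digitLaw_pair_le ht d) _ s
    _ ≤ _ := by
        rw [← ENNReal.ofReal_sum_of_nonneg fun d _ => by split_ifs <;> positivity]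
        refine ENNReal.ofReal_le_ofReal ?_
        rw [Finset.sum_add_distrib, Finset.sum_const, Finset.card_range, nsmul_eq_mul]
        have h5 : ∑ d ∈ Finset.range n, (if d < 2 then 41472 * (Real.log t / t) else 0) ≤
            2 * (41472 * (Real.log t / t)) := by
          rw [← Finset.sum_filter]
          calc _ ≤ ∑ d ∈ Finset.range 2, 41472 * (Real.log t / t) := by
                refine Finset.sum_le_sum_of_subset_of_nonneg (fun d hd => ?_)
                  fun d _ _ => by positivity
                exact Finset.mem_range.2 (Finset.mem_filter.1 hd).2
            _ = _ := by simp
        push_cast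
        rw [mul_div_assoc]
        linarith

lemma digitLaw_largeTripleSet_eq_zero {φ : ℕ → ℝ} (hmono : MonotoneOn φ (Ici 1))
    (htwo : ∀ n : ℕ, 1 ≤ n → 2 ≤ φ n)
    (hsum : Summable fun n : ℕ =>
      (n : ℝ) * Real.log (φ n) ^ 4 / φ n ^ 2 + Real.log (φ n) / φ n) (s : unitInterval) :
    digitLaw s (largeTripleSet φ) = 0 := by
  have hnn (n : ℕ) (hn : 1 ≤ n) : 0 ≤ (n : ℝ) * Real.log (φ n) ^ 4 / φ n ^ 2 := by positivity
  -- Since log φ ≥ 1/2, a bounded φ(n) would keep log φ(n)/φ(n) away from 0.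
  have htop (M : ℝ) : ∀ᶠ n in atTop, M < φ n := by
    have h := hsum.tendsto_atTop_zero
    have hpos : 0 < 1 / 2 / (max M 1) := by positivity
    filter_upwards [h.eventually (gt_mem_nhds hpos), eventually_ge_atTop 1] with n hn hn1
    by_contra! hM
    have h2 := htwo n hn1
    have : 1 / 2 / (max M 1) ≤ Real.log (φ n) / φ n :=
      div_le_div₀ (Real.log_nonneg (by linarith)) (half_le_log h2) (by linarith)
        (hM.trans (le_max_left _ _))
    linarith [hnn n hn1]
  have hsub : largeTripleSet φ ⊆ {σ | ∃ᶠ n in atTop, σ ∈ pairSet (φ (n + 1)) n} := by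
    intro σ hσ
    rw [mem_ofPred_eq, frequently_atTop]
    intro N
    -- Choosing φ(n) above the sum of the first N triple products forces k ≥ N, so the later
    -- positions are unbounded.
    obtain ⟨n, ⟨j, k, hjk, hkn, h1, h2⟩, hn, hn1⟩ := (Frequently.and_eventually hσ
      ((htop (∑ k ∈ Finset.range N, ∏ i ∈ Finset.range 3, ((shift k σ i : ℝ) + 1))).and
        (eventually_ge_atTop 1))).exists
    have hφ : φ (k + 1) ≤ φ n := hmono (by simp) hn1 hkn
    refine ⟨k, ?_, j, hjk, hφ.trans h1, hφ.trans h2⟩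
    by_contra! hkN
    have h3 : ∏ i ∈ Finset.range 3, ((shift k σ i : ℝ) + 1) ≤
        ∑ k ∈ Finset.range N, ∏ i ∈ Finset.range 3, ((shift k σ i : ℝ) + 1) :=
      Finset.single_le_sum (f := fun k => ∏ i ∈ Finset.range 3, ((shift k σ i : ℝ) + 1))
        (fun k _ => by positivity) (Finset.mem_range.2 hkN)
    rw [productSet, mem_ofPred_eq] at h2
    linarith
  refine measure_mono_null hsub (measure_setOfPred_frequently_eq_zero ?_)
  have hle (n : ℕ) := digitLaw_pairSet_le (htwo (n + 1) (by omega)) n s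
  refine ne_top_of_le_ne_top ?_ (ENNReal.tsum_le_tsum hle)
  exact (((summable_nat_add_iff 1).2 hsum).mul_left 1679616).tsum_ofReal_ne_top

/-! ### The divergence half. -/

lemma log_div_le {s t : ℝ} (hs : 2 ≤ s) (hst : s ≤ t) :
    Real.log t / t ≤ 2 * (Real.log s / s) := by
  have hs0 : 0 < s := by linarith
  have ht0 : 0 < t := by linarith
  have hL := half_le_log hs
  have hu : 1 ≤ t / s := (one_le_div hs0).2 hst
  have h1 := Real.log_le_sub_one_of_pos (div_pos ht0 hs0)
  rw [Real.log_div ht0.ne' hs0.ne'] at h1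
  -- log t ≤ log s + t/s - 1, and log s ≥ 1/2. A constant is needed because log t/t increases on
  -- [2,e].
  have h2 : Real.log t ≤ 2 * Real.log s * (t / s) := by nlinarith
  calc Real.log t / t ≤ 2 * Real.log s * (t / s) / t := by gcongr
    _ = _ := by field_simp

lemma log_sq_div_le {s t : ℝ} (hs : 2 ≤ s) (hst : s ≤ t) :
    Real.log t ^ 2 / t ≤ 16 * (Real.log s ^ 2 / s) := by
  have hs0 : 0 < s := by linarith
  have ht0 : 0 < t := by linarith
  have hL := half_le_log hs
  have hu : 1 ≤ t / s := (one_le_div hs0).2 hst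
  have hq : 1 ≤ √(t / s) := Real.one_le_sqrt.2 hu
  have h1 := Real.log_le_sub_one_of_pos (zero_lt_one.trans_le hq)
  rw [Real.log_sqrt (by positivity), Real.log_div ht0.ne' hs0.ne'] at h1
  have h2 : Real.log t ≤ 4 * Real.log s * √(t / s) := by nlinarith
  calc Real.log t ^ 2 / t ≤ (4 * Real.log s * √(t / s)) ^ 2 / t := by
        have := half_le_log (hs.trans hst)
        gcongr
    _ = 16 * Real.log s ^ 2 * (t / s) / t := by
        rw [mul_pow, mul_pow, Real.sq_sqrt (by positivity)]; norm_num
    _ = _ := by field_simp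

lemma ae_mem_largeTripleSet_of_not_summable_log {φ : ℕ → ℝ} (hmono : MonotoneOn φ (Ici 1))
    (htwo : ∀ n : ℕ, 1 ≤ n → 2 ≤ φ n)
    (hsum : ¬ Summable fun n : ℕ => Real.log (φ n) / φ n) (s : unitInterval) :
    ∀ᵐ σ ∂digitLaw s, σ ∈ largeTripleSet φ := by
  obtain ⟨c, hc, hcp⟩ := exists_le_digitLaw_productSet 1
  have h2 (i : ℕ) : 2 ≤ φ (2 * i + 2) := htwo _ (by omega)
  have hnn (n : ℕ) (hn : 1 ≤ n) : 0 ≤ Real.log (φ n) / φ n :=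
    div_nonneg (Real.log_nonneg (by linarith [htwo n hn])) (by linarith [htwo n hn])
  have hns : ¬ Summable fun i : ℕ => c * (Real.log (φ (2 * i + 2)) / φ (2 * i + 2)) := by
    rw [summable_mul_left_iff hc.ne']
    intro he
    refine hsum ((summable_nat_add_iff 2).1 (Summable.even_add_odd he ?_))
    refine Summable.of_nonneg_of_le (fun i => hnn _ (by omega)) (fun i => ?_) (he.mul_left 2)
    exact log_div_le (h2 i) (hmono (by simp) (by simp) (by omega))
  have hae := ae_frequently_shift_mem (E := fun i => productSet 2 (φ (2 * i + 2)))
    (l := fun _ => 2) (fun i => measurableSet_productSet _ _)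
    (fun i => dependsOn_productSet _ _) (fun i => mul_nonneg hc.le (hnn _ (by omega)))
    (fun i s => by simpa using hcp (φ (2 * i + 2)) (by linarith [h2 i]) s) hns s
  filter_upwards [hae] with σ hσ
  rw [largeTripleSet, mem_ofPred_eq, frequently_atTop]
  intro N
  obtain ⟨i, hi, hiN⟩ := (hσ.and_eventually (eventually_ge_atTop (N + 1))).exists
  -- The large pair occupies digits 2i and 2i+1, and the triples starting at 2i-1 and 2i both
  -- contain it; their third factor is at least 1. Here i ≥ 1, so the subtraction is genuine.
  refine ⟨2 * i + 2, by omega, 2 * i - 1, 2 * i, by omega, by omega, ?_⟩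
  simp only [Finset.sum_const, Finset.card_range, smul_eq_mul, productSet, mem_ofPred_eq,
    Finset.prod_range_succ, Finset.prod_range_zero, shift, one_mul, zero_add, mul_comm i 2] at hi ⊢
  rw [show 1 + (2 * i - 1) = 2 * i by omega, show 2 + (2 * i - 1) = 1 + 2 * i by omega]
  have e (m : ℕ) : (1 : ℝ) ≤ (σ m : ℝ) + 1 := by linarith [(σ m).cast_nonneg (α := ℝ)]
  have hpos : (0 : ℝ) ≤ ((σ (2 * i) : ℝ) + 1) * ((σ (1 + 2 * i) : ℝ) + 1) := by positivity
  constructor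
  · rw [mul_assoc]
    exact hi.trans (le_mul_of_one_le_left hpos (e _))
  · exact hi.trans (le_mul_of_one_le_right hpos (e _))

/-- A condensation test for terms that are almost decreasing along `12 * 2 ^ i`. -/
lemma summable_of_summable_condensed {h y : ℕ → ℝ} {C : ℝ} (hh : ∀ n, 0 ≤ h n) (hC : 0 ≤ C)
    (hy0 : ∀ i, 0 ≤ y i) (hy : Summable y)
    (hle : ∀ i n, 12 * 2 ^ i ≤ n → n < 12 * 2 ^ (i + 1) → (12 * 2 ^ i) * h n ≤ C * y i) :
    Summable h := by
  have hblock (K : ℕ) : ∑ n ∈ Finset.range (12 * 2 ^ K), h n ≤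
      ∑ n ∈ Finset.range 12, h n + C * ∑ i ∈ Finset.range K, y i := by
    induction K with
    | zero => simp
    | succ K ih =>
      have hK : 12 * 2 ^ K ≤ 12 * 2 ^ (K + 1) := by
        rw [pow_succ]; omega
      rw [← Finset.sum_range_add_sum_Ico _ hK, Finset.sum_range_succ y, mul_add, ← add_assoc]
      refine add_le_add ih ?_
      have hb : ∀ n ∈ Finset.Ico (12 * 2 ^ K) (12 * 2 ^ (K + 1)),
          h n ≤ C * y K / (12 * 2 ^ K) := by
        intro n hn
        rw [Finset.mem_Ico] at hn
        rw [le_div_iff₀ (by positivity), mul_comm]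
        exact hle K n hn.1 hn.2
      refine (Finset.sum_le_sum hb).trans_eq ?_
      rw [Finset.sum_const, Nat.card_Ico, show 12 * 2 ^ (K + 1) - 12 * 2 ^ K = 12 * 2 ^ K by
        rw [pow_succ]; omega, nsmul_eq_mul]
      push_cast
      field_simp
  refine summable_of_sum_range_le (c := ∑ n ∈ Finset.range 12, h n + C * ∑' i, y i) hh fun n => ?_
  have hn : n ≤ 12 * 2 ^ n := by
    have := Nat.lt_two_pow_self (n := n)
    omega
  calc ∑ i ∈ Finset.range n, h i ≤ ∑ i ∈ Finset.range (12 * 2 ^ n), h i :=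
        Finset.sum_le_sum_of_subset_of_nonneg (Finset.range_mono hn) fun i _ _ => hh i
    _ ≤ _ := hblock n
    _ ≤ _ := by
        gcongr
        exact hy.sum_le_tsum _ fun i _ => hy0 i

lemma summable_of_summable_condensed_min {φ : ℕ → ℝ} (hmono : MonotoneOn φ (Ici 1))
    (htwo : ∀ n : ℕ, 1 ≤ n → 2 ≤ φ n) {c : ℝ} (hc : 0 < c)
    (hsum : Summable fun i : ℕ => (min 1 (((2 ^ i : ℕ) : ℝ) *
      (c * (Real.log (φ (12 * 2 ^ i)) ^ 2 / φ (12 * 2 ^ i)))) / 2) ^ 2) :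
    Summable fun n : ℕ => (n : ℝ) * Real.log (φ n) ^ 4 / φ n ^ 2 := by
  set g : ℕ → ℝ := fun n => Real.log (φ n) ^ 2 / φ n with hg
  have h1 (i : ℕ) : 1 ≤ 12 * 2 ^ i := by
    have := Nat.one_le_two_pow (n := i)
    omega
  have hg0 (n : ℕ) (hn : 1 ≤ n) : 0 ≤ g n := by
    have := htwo n hn
    positivity
  have hy : Summable fun i : ℕ => ((2 : ℝ) ^ i * g (12 * 2 ^ i)) ^ 2 := by
    have hlt := hsum.tendsto_atTop_zero.eventually (gt_mem_nhds (by norm_num : (0 : ℝ) < 1 / 4))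
    refine (summable_mul_left_iff (a := c ^ 2 / 4) (by positivity)).1 ?_
    refine (summable_congr_atTop ?_).1 hsum
    filter_upwards [hlt] with i hi
    -- A minimum equal to 1 would make the term 1/4, so the truncation is eventually inactive.
    have hmin : min 1 (((2 ^ i : ℕ) : ℝ) * (c * g (12 * 2 ^ i))) =
        ((2 ^ i : ℕ) : ℝ) * (c * g (12 * 2 ^ i)) := by
      rcases le_total 1 (((2 ^ i : ℕ) : ℝ) * (c * g (12 * 2 ^ i))) with h | h
      · rw [min_eq_left h] at hi
        norm_num at hi
      · exact min_eq_right h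
    rw [hmin]
    push_cast
    ring
  refine summable_of_summable_condensed (C := 73728) (fun n => by positivity) (by norm_num)
    (fun i => sq_nonneg _) hy fun i n hin hni => ?_
  have hn1 : 1 ≤ n := (h1 i).trans hin
  have hgn : g n ≤ 16 * g (12 * 2 ^ i) := log_sq_div_le (htwo _ (h1 i)) (hmono (h1 i) hn1 hin)
  have hn : (n : ℝ) ≤ 24 * 2 ^ i := by
    have : n ≤ 24 * 2 ^ i := by
      rw [pow_succ] at hni; omega
    exact_mod_cast this
  have := hg0 n hn1
  calc (12 * 2 ^ i : ℝ) * (n * Real.log (φ n) ^ 4 / φ n ^ 2) = (12 * 2 ^ i) * (n * g n ^ 2) := by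
        rw [hg]; ring
    _ ≤ (12 * 2 ^ i) * ((24 * 2 ^ i) * (16 * g (12 * 2 ^ i)) ^ 2) := by gcongr
    _ = 73728 * (2 ^ i * g (12 * 2 ^ i)) ^ 2 := by ring

lemma ae_mem_largeTripleSet_of_not_summable_log_pow {φ : ℕ → ℝ} (hmono : MonotoneOn φ (Ici 1))
    (htwo : ∀ n : ℕ, 1 ≤ n → 2 ≤ φ n)
    (hsum : ¬ Summable fun n : ℕ => (n : ℝ) * Real.log (φ n) ^ 4 / φ n ^ 2) (s : unitInterval) :
    ∀ᵐ σ ∂digitLaw s, σ ∈ largeTripleSet φ := by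
  obtain ⟨c, hc, hcp⟩ := exists_le_digitLaw_productSet 2
  have h2 (i : ℕ) : 2 ≤ φ (12 * 2 ^ i) := htwo _ (by
    have := Nat.one_le_two_pow (n := i)
    omega)
  have hp0 (i : ℕ) : 0 ≤ c * (Real.log (φ (12 * 2 ^ i)) ^ 2 / φ (12 * 2 ^ i)) := by
    have := h2 i
    positivity
  have hae := ae_frequently_shift_mem (E := fun i => twoTriplesSet (2 ^ i) (φ (12 * 2 ^ i)))
    (l := fun i => 6 * 2 ^ i) (fun i => measurableSet_twoTriplesSet _ _)
    (fun i => dependsOn_twoTriplesSet _ _) (fun i => sq_nonneg _)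
    (fun i s => le_digitLaw_twoTriplesSet (hp0 i) (hcp _ (by linarith [h2 i])) s)
    (fun h => hsum (summable_of_summable_condensed_min hmono htwo hc h)) s
  filter_upwards [hae] with σ hσ
  rw [largeTripleSet, mem_ofPred_eq, frequently_atTop]
  intro N
  obtain ⟨i, ⟨⟨j, hj, h3⟩, ⟨k, hk, h4⟩⟩, hiN⟩ :=
    (hσ.and_eventually (eventually_ge_atTop N)).exists
  -- Block i has two halves of 2^i triples and starts at digit 6·2^i - 6, so it ends before n =
  -- 12·2^i; this is the origin of the 12.
  have hlen : ∑ j ∈ Finset.range i, 6 * 2 ^ j + 6 = 6 * 2 ^ i := by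
    clear hiN hj h3 hk h4
    induction i with
    | zero => simp
    | succ i ih => rw [Finset.sum_range_succ, pow_succ]; omega
  have hi := Nat.lt_two_pow_self (n := i)
  simp only [shift_shift] at h3 h4
  exact ⟨12 * 2 ^ i, by omega, _, _, by omega, by omega, h3, h4⟩

lemma digitLaw_largeTripleSet_eq_one {φ : ℕ → ℝ} (hmono : MonotoneOn φ (Ici 1))
    (htwo : ∀ n : ℕ, 1 ≤ n → 2 ≤ φ n)
    (hsum : ¬ Summable fun n : ℕ =>
      (n : ℝ) * Real.log (φ n) ^ 4 / φ n ^ 2 + Real.log (φ n) / φ n) (s : unitInterval) :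
    digitLaw s (largeTripleSet φ) = 1 := by
  refine (mem_ae_iff_prob_eq_one (measurableSet_largeTripleSet φ)).1 ?_
  by_cases h : Summable fun n : ℕ => Real.log (φ n) / φ n
  · exact ae_mem_largeTripleSet_of_not_summable_log_pow hmono htwo
      (fun h' => hsum (h'.add h)) s
  · exact ae_mem_largeTripleSet_of_not_summable_log hmono htwo h s

end PartialQuotients

theorem mainTheorem1 (φ : ℕ → ℝ) (hmono : MonotoneOn φ (Set.Ici 1))
    (htwo : ∀ n : ℕ, 1 ≤ n → 2 ≤ φ n) :
    MeasurableSet (largeProductSet 3 φ) ∧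
    (Summable (fun n : ℕ+ =>
        (n : ℝ) * Real.log (φ n) ^ 4 / φ n ^ 2 + Real.log (φ n) / φ n) →
      volume (largeProductSet 3 φ) = 0) ∧
    (¬ Summable (fun n : ℕ+ =>
        (n : ℝ) * Real.log (φ n) ^ 4 / φ n ^ 2 + Real.log (φ n) / φ n) →
      volume (largeProductSet 3 φ) = 1) := by
  -- The value φ(0) is unconstrained, but a single term does not affect summability.
  have hiff := summable_pnat_iff_summable_nat (f := fun n : ℕ =>
    (n : ℝ) * Real.log (φ n) ^ 4 / φ n ^ 2 + Real.log (φ n) / φ n)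
  rw [PartialQuotients.volume_largeProductSet]
  exact ⟨PartialQuotients.measurableSet_largeProductSet φ,
    fun h => PartialQuotients.digitLaw_largeTripleSet_eq_zero hmono htwo (hiff.1 h) 0,
    fun h => PartialQuotients.digitLaw_largeTripleSet_eq_one hmono htwo (mt hiff.2 h) 0⟩
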